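/- Let $(c_k)_{k\ge 1}$ be a sequence of non-negative real numbers, put $c_0=0$ and $C(x)=\sum_{k\ge 1}c_kx^k$. Suppose that $C$ is subexponential with radius of convergence $\rho$, where $0<\rho<1$; that is, as $n\to\infty$, $$\frac{c_{n-1}}{c_n}\to\rho\qquad\text{and}\qquad \frac1{c_n}\sum_{0\le k\le n}c_kc_{n-k}\to 2C(\rho)<\infty .$$ Let $m=\min\{k\ge 1: c_k>0\}$, and define the formal power series $$G(x,y)=\exp\Big(\sum_{j\ge 1}\frac{y^j\,C(x^j)}{j}\Big).$$ Then, as $n$, $N$ and $n-mN$ all tend to infinity, $$[x^ny^N]\,G(x,y)\sim A\cdot N^{c_m-1}\cdot c_{n-m(N-1)},\qquad\text{where}\quad A=\frac1{\Gamma(c_m)}\exp\Big(\sum_{j\ge 1}\frac{C(\rho^j)-c_m\rho^{jm}}{j\,\rho^{jm}}\Big),$$ and all the series in the definition of $A$ converge. Here $a_{n,N}\sim b_{n,N}$ means that $a_{n,N}/b_{n,N}\to 1$: for every $\varepsilon>0$ there is a $K$ such that $|a_{n,N}-b_{n,N}|\le\varepsilon\, |b_{n,N}|$ whenever $n$, $N$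 and $n-mN$ are all at least $K$. -/

import Mathlib

open Filter Topology Asymptotics

noncomputable section

/-- The value `C(z) = ∑_{k ≥ 0} c_k z^k` of the power series with coefficients `c`. -/
def seriesValue (c : ℕ → ℝ) (z : ℝ) : ℝ := ∑' k : ℕ, c k * z ^ k

/-- The power series `C(x) = ∑ c_k x^k` with non-negative real coefficients is subexponential with
radius of convergence `ρ > 0`: `c_{n-1} / c_n → ρ`, `C(ρ) < ∞`, and
`(1 / c_n) ∑_{0 ≤ k ≤ n} c_k c_{n-k} → 2 C(ρ)`.
As `ρ > 0`, the first limit forces `c_n > 0` for all large `n`, and that the radius of convergence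
of `C` is `ρ`. -/
structure IsSubexponential (c : ℕ → ℝ) (ρ : ℝ) : Prop where
  nonneg : ∀ k, 0 ≤ c k
  radius_pos : 0 < ρ
  tendsto_ratio : Tendsto (fun n : ℕ => c n / c (n + 1)) atTop (𝓝 ρ)
  summable : Summable fun k : ℕ => c k * ρ ^ k
  tendsto_conv : Tendsto
    (fun n : ℕ => (∑ k ∈ Finset.range (n + 1), c k * c (n - k)) / c n)
    atTop (𝓝 (2 * seriesValue c ρ))

/-- The formal power series `∑_{j ≥ 1} y^j C(x^j) / j`, as a power series in `y` whose coefficients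
are power series in `x`. -/
def multisetExponent (c : ℕ → ℝ) : PowerSeries (PowerSeries ℝ) :=
  PowerSeries.mk fun j : ℕ =>
    if hj : j = 0 then 0 else (1 / (j : ℝ)) • PowerSeries.expand j hj (PowerSeries.mk c)

/-- The exponent has zero constant term in `y`, so that it may be substituted into `exp`. -/
theorem hasSubst_multisetExponent (c : ℕ → ℝ) : PowerSeries.HasSubst (multisetExponent c) := by
  apply PowerSeries.HasSubst.of_constantCoeff_zero'
  rw [← PowerSeries.coeff_zero_eq_constantCoeff_apply]
  simp [multisetExponent]

/-- The formal power series `G(x, y) = exp (∑_{j ≥ 1} y^j C(x^j) / j)`, as a power series in `y`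
whose coefficients are power series in `x`. -/
def multisetSeries (c : ℕ → ℝ) : PowerSeries (PowerSeries ℝ) :=
  (PowerSeries.exp ℝ).subst (multisetExponent c)

/-- The coefficient `[x^n y^N] G(x, y)`. -/
def multisetCoeff (c : ℕ → ℝ) (n N : ℕ) : ℝ :=
  PowerSeries.coeff n (PowerSeries.coeff N (multisetSeries c))

/-- The filter on pairs `(n, N)` expressing that `n`, `N` and the integer `n - m N` all tend to
infinity. -/
def jointlyToInfinity (m : ℕ) : Filter (ℕ × ℕ) :=
  comap (fun p : ℕ × ℕ => p.1) atTop ⊓ comap (fun p : ℕ × ℕ => p.2) atTop ⊓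
    comap (fun p : ℕ × ℕ => (p.1 : ℤ) - (m : ℤ) * (p.2 : ℤ)) atTop

/-- The `j`-th term `(C(ρ^j) - c_m ρ^{jm}) / (j ρ^{jm})` of the exponent of the constant. -/
def constantTerm (c : ℕ → ℝ) (ρ : ℝ) (m j : ℕ) : ℝ :=
  (seriesValue c (ρ ^ j) - c m * ρ ^ (j * m)) / ((j : ℝ) * ρ ^ (j * m))

/-- The constant `A = Γ(c_m)⁻¹ exp (∑_{j ≥ 1} (C(ρ^j) - c_m ρ^{jm}) / (j ρ^{jm}))`. -/
def multisetConstant (c : ℕ → ℝ) (ρ : ℝ) (m : ℕ) : ℝ :=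
  (Real.Gamma (c m))⁻¹ * Real.exp (∑' j : ℕ, constantTerm c ρ m (j + 1))

end

/-!
The factor `exp (∑ y^j c_m x^{jm} / j) = (1 - y x^m)^{-c_m}` of `G` carries the growth in `N`.
Replacing `y` by `y x^{-m}` turns it into `(1 - y)^{-c_m}` and the rest of `G` into the multiset
series `F` of `b_k = c_{k+m}` (`k ≥ 1`), so that, writing `f_{M,l} = [x^M y^l] F`,
`[x^{M+mN} y^N] G = ∑_{l ≤ N} β_{N-l} f_{M,l}`, where `β_k = [y^k] (1 - y)^{-c_m}`
(`multisetCoeff_eq_sum`).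

Two facts about `F` at fixed real `y` are needed. The coefficient `g_M = [x^M] F(x, y)` satisfies
`M g_M = ∑ k t_k g_{M-k}` with `t_k = [x^k] log F(x, y)`. As `ρ < 1`, the terms `j ≥ 2` of
`∑ y^j B(x^j) / j` have a larger radius of convergence than `B` as long as `y ≤ ρ^{-1/2}`, whence
`t_k ∼ y b_k` (`tendsto_logCoeff_div`). Subexponentiality says that in `∑ b_k b_{M-k}` only the two
ends matter (`MiddleNegligible`); fed into the recurrence, this gives `g_M = O(b_M)`
(`exists_le_mul_of_recurrence`) and then `g_M / b_M → y ∑ g_i ρ^i`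
(`tendsto_div_of_recurrence`).

At `y = ρ^{-1/2} > 1` the bound yields `f_{M,l} ≤ K ρ^{l/2} b_M` (`exists_multisetCoeff_le`); at
`y = 1` the limit yields `∑_l f_{M,l} ∼ exp (∑_j B(ρ^j) / j) b_M` (`tendsto_evalCoeff_one_div`).
Since `β_{N-l} / N^{c_m - 1}` tends to `1 / Γ(c_m)` for fixed `l` and is `O(l + 1)` uniformly in
`N`, dominated convergence replaces it by `1 / Γ(c_m)` in the sum, with an error depending on `N`
only (`tendsto_weighted_error`, `abs_multisetCoeff_div_sub_le`). This is why no relation between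
the speeds of `N` and `n - m N` is required.
-/

section PowerSeriesPart

open PowerSeries

/-! ### Exponentials of power series -/

theorem PowerSeries.derivative_exp_subst {R : Type*} [CommRing R] [Algebra ℝ R] {E : PowerSeries R}
    (hE : HasSubst E) :
    d⁄dX R ((exp ℝ).subst E) = d⁄dX R E * (exp ℝ).subst E := by
  have key : (exp ℝ).subst E = ((exp ℝ).map (algebraMap ℝ R)).subst E := by
    ext n
    rw [coeff_subst' hE, coeff_subst' hE]
    refine finsum_congr fun d => ?_
    rw [coeff_map, smul_eq_mul, Algebra.smul_def]
  have hd : d⁄dX R ((exp ℝ).map (algebraMap ℝ R)) = (exp ℝ).map (algebraMap ℝ R) := by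
    ext n
    have h := congrArg (coeff n) (derivative_exp ℝ)
    rw [coeff_derivative] at h
    rw [coeff_derivative, coeff_map, coeff_map, ← h]
    simp
  rw [key, derivative_subst hE, hd, mul_comm]

theorem PowerSeries.constantCoeff_exp_subst {R : Type*} [CommRing R] [Algebra ℝ R]
    {E : PowerSeries R}
    (hE : constantCoeff E = 0) : constantCoeff ((exp ℝ).subst E) = 1 := by
  have hs : HasSubst E := HasSubst.of_constantCoeff_zero' hE
  have h := constantCoeff_subst hs (exp ℝ)
  change constantCoeff ((exp ℝ).subst E) = _ at h
  rw [h, finsum_eq_single _ 0]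
  · simp
  · intro n hn
    have : MvPowerSeries.constantCoeff (E ^ n) = 0 := by
      rw [map_pow, show MvPowerSeries.constantCoeff E = 0 from hE, zero_pow hn]
    rw [this, smul_zero]

/-- A linear differential equation `F' = P F` determines `F` from its constant coefficient. -/
theorem PowerSeries.eq_of_derivative_eq_mul {R : Type*} [CommRing R] [Algebra ℝ R]
    {P F G : PowerSeries R}
    (hF : d⁄dX R F = P * F) (hG : d⁄dX R G = P * G) (h0 : constantCoeff F = constantCoeff G) :
    F = G := by
  have h : ∀ n, coeff n F = coeff n G := by
    intro n
    induction n using Nat.strong_induction_on with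
    | _ n ih =>
      cases n with
      | zero => simpa using h0
      | succ n =>
        have h1 := congrArg (coeff n) hF
        have h2 := congrArg (coeff n) hG
        rw [coeff_derivative, coeff_mul] at h1 h2
        have h3 : coeff (n + 1) F * ((n : R) + 1) = coeff (n + 1) G * ((n : R) + 1) := by
          rw [h1, h2]
          refine Finset.sum_congr rfl fun p hp => ?_
          rw [ih p.2 (by have := Finset.HasAntidiagonal.mem_antidiagonal.1 hp; omega)]
        have hu : IsUnit ((n : R) + 1) := by
          have : ((n : R) + 1) = algebraMap ℝ R ((n : ℝ) + 1) := by simp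
          rw [this]
          exact (IsUnit.mk0 _ (by positivity)).map _
        exact hu.mul_left_injective h3
  ext n
  exact h n

/-- Apply a derivation of the coefficient ring to every coefficient of a power series. -/
noncomputable def PowerSeries.coeffwise {R : Type*} [CommRing R] [Algebra ℝ R]
    (δ : Derivation ℝ R R)
    (F : PowerSeries R) : PowerSeries R :=
  PowerSeries.mk fun n => δ (PowerSeries.coeff n F)

theorem PowerSeries.coeffwise_mul {R : Type*} [CommRing R] [Algebra ℝ R] (δ : Derivation ℝ R R)
    (F G : PowerSeries R) :
    coeffwise δ (F * G) = coeffwise δ F * G + F * coeffwise δ G := by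
  ext n
  simp only [coeffwise, coeff_mk, coeff_mul, map_add, map_sum, Derivation.leibniz, smul_eq_mul,
    ← Finset.sum_add_distrib]
  exact Finset.sum_congr rfl fun p _ => by ring

theorem PowerSeries.derivative_coeffwise {R : Type*} [CommRing R] [Algebra ℝ R]
    (δ : Derivation ℝ R R)
    (F : PowerSeries R) : d⁄dX R (coeffwise δ F) = coeffwise δ (d⁄dX R F) := by
  ext n
  simp only [coeffwise, coeff_mk, coeff_derivative, Derivation.leibniz, smul_eq_mul, map_add,
    Derivation.map_natCast, Derivation.map_one_eq_zero]
  ring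

/-- The chain rule for the exponential and a derivation acting on the coefficients: both sides have
the same constant coefficient and solve the differential equation `Z' - E' Z = (δ E)' exp E`. -/
theorem PowerSeries.coeffwise_exp_subst {R : Type*} [CommRing R] [Algebra ℝ R]
    (δ : Derivation ℝ R R)
    {E : PowerSeries R} (hE : constantCoeff E = 0) :
    coeffwise δ ((exp ℝ).subst E) = coeffwise δ E * (exp ℝ).subst E := by
  have hs : HasSubst E := HasSubst.of_constantCoeff_zero' hE
  have hF := derivative_exp_subst hs
  have h1 := constantCoeff_exp_subst hE
  set F : PowerSeries R := (exp ℝ).subst E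
  have hZ : coeffwise δ F - coeffwise δ E * F = 0 := by
    refine eq_of_derivative_eq_mul (P := d⁄dX R E) ?_ (by simp) ?_
    · rw [map_sub, Derivation.leibniz, derivative_coeffwise, derivative_coeffwise, hF,
        coeffwise_mul, smul_eq_mul, smul_eq_mul]
      ring
    · have a1 : constantCoeff (coeffwise δ F) = 0 := by
        rw [← coeff_zero_eq_constantCoeff_apply] at h1 ⊢
        rw [coeffwise, coeff_mk, h1, Derivation.map_one_eq_zero]
      have a2 : constantCoeff (coeffwise δ E) = 0 := by
        rw [← coeff_zero_eq_constantCoeff_apply] at hE ⊢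
        rw [coeffwise, coeff_mk, hE, map_zero]
      rw [map_sub, map_mul, a1, a2]
      simp
  exact sub_eq_zero.1 hZ

/-! ### The multiset series and its recurrences -/

theorem constantCoeff_multisetExponent (c : ℕ → ℝ) : constantCoeff (multisetExponent c) = 0 := by
  rw [← coeff_zero_eq_constantCoeff_apply]
  simp [multisetExponent]

theorem coeff_zero_multisetSeries (c : ℕ → ℝ) : coeff 0 (multisetSeries c) = 1 := by
  rw [coeff_zero_eq_constantCoeff_apply]
  exact constantCoeff_exp_subst (constantCoeff_multisetExponent c)

/-- The differential equation `∂G/∂y = (∑_{j ≥ 1} y^{j-1} C(x^j)) G`. -/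
theorem derivative_multisetSeries (c : ℕ → ℝ) :
    d⁄dX (PowerSeries ℝ) (multisetSeries c) =
      (PowerSeries.mk fun j : ℕ => expand (j + 1) j.succ_ne_zero (PowerSeries.mk c)) *
        multisetSeries c := by
  rw [multisetSeries, derivative_exp_subst (hasSubst_multisetExponent c)]
  congr 1
  ext1 j
  rw [coeff_derivative, multisetExponent, coeff_mk, coeff_mk, dif_neg j.succ_ne_zero,
    smul_mul_assoc, mul_comm, ← Nat.cast_succ, ← nsmul_eq_mul, ← Nat.cast_smul_eq_nsmul ℝ,
    smul_smul, one_div, inv_mul_cancel₀ (by positivity), one_smul]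

theorem succ_mul_coeff_multisetSeries (c : ℕ → ℝ) (N : ℕ) :
    coeff (N + 1) (multisetSeries c) * ((N : PowerSeries ℝ) + 1) =
      ∑ p ∈ Finset.HasAntidiagonal.antidiagonal N,
        expand (p.1 + 1) p.1.succ_ne_zero (PowerSeries.mk c) * coeff p.2 (multisetSeries c) := by
  have h := congrArg (coeff N) (derivative_multisetSeries c)
  rw [coeff_derivative, coeff_mul] at h
  simpa only [coeff_mk] using h

theorem PowerSeries.X_pow_dvd_expand {b : ℕ → ℝ} (hb : b 0 = 0) (j : ℕ) (hj : j ≠ 0) :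
    (X : PowerSeries ℝ) ^ j ∣ expand j hj (PowerSeries.mk b) := by
  rw [X_pow_dvd_iff]
  intro k hk
  rw [coeff_expand]
  split_ifs with h
  · obtain ⟨i, rfl⟩ := h
    have : i = 0 := by
      by_contra h0
      have := Nat.le_mul_of_pos_right j (Nat.pos_of_ne_zero h0)
      omega
    simp [this, hb]
  · rfl

/-- Combinatorially, a multiset of `N` objects of size at least `1` has size at least `N`. -/
theorem X_pow_dvd_coeff_multisetSeries {b : ℕ → ℝ} (hb : b 0 = 0) (N : ℕ) :
    (X : PowerSeries ℝ) ^ N ∣ coeff N (multisetSeries b) := by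
  induction N using Nat.strong_induction_on with
  | _ N ih =>
    cases N with
    | zero => simp
    | succ N =>
      have hu : IsUnit ((N : PowerSeries ℝ) + 1) := by
        have : ((N : PowerSeries ℝ) + 1) = algebraMap ℝ (PowerSeries ℝ) ((N : ℝ) + 1) := by simp
        rw [this]
        exact (IsUnit.mk0 _ (by positivity)).map _
      rw [← hu.dvd_mul_right, succ_mul_coeff_multisetSeries]
      refine Finset.dvd_sum fun p hp => ?_
      have hp' := Finset.HasAntidiagonal.mem_antidiagonal.1 hp
      have : (X : PowerSeries ℝ) ^ (N + 1) = X ^ (p.1 + 1) * X ^ p.2 := by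
        rw [← pow_add]; congr 1; omega
      rw [this]
      exact mul_dvd_mul (X_pow_dvd_expand hb _ _) (ih p.2 (by omega))

theorem multisetCoeff_eq_zero {b : ℕ → ℝ} (hb : b 0 = 0) {M l : ℕ} (h : M < l) :
    multisetCoeff b M l = 0 :=
  X_pow_dvd_iff.1 (X_pow_dvd_coeff_multisetSeries hb l) M h

theorem multisetCoeff_nonneg {b : ℕ → ℝ} (hb : ∀ k, 0 ≤ b k) (M l : ℕ) :
    0 ≤ multisetCoeff b M l := by
  induction l using Nat.strong_induction_on generalizing M with
  | _ l ih =>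
    cases l with
    | zero =>
      rw [multisetCoeff, coeff_zero_multisetSeries, coeff_one]
      split_ifs <;> norm_num
    | succ l =>
      have h := congrArg (coeff M) (succ_mul_coeff_multisetSeries b l)
      have e : ((l : PowerSeries ℝ) + 1) = C ((l : ℝ) + 1) := by simp
      rw [e, coeff_mul_C, map_sum] at h
      have : 0 ≤ multisetCoeff b M (l + 1) * ((l : ℝ) + 1) := by
        rw [multisetCoeff, h]
        refine Finset.sum_nonneg fun p hp => ?_
        have hp' := Finset.HasAntidiagonal.mem_antidiagonal.1 hp
        rw [coeff_mul]
        refine Finset.sum_nonneg fun q _ => mul_nonneg ?_ (ih p.2 (by omega) _)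
        rw [coeff_expand]
        split_ifs
        · simpa using hb _
        · rfl
      exact nonneg_of_mul_nonneg_left this (by positivity)

/-! ### Splitting off the lowest term of `C` -/

/-- The coefficients of `x^{-m} (C(x) - c_m x^m)` when `c` vanishes below `m`. The value at `0` is
set to `0`, so that `c_m` itself is left out. -/
def shiftCoeff (c : ℕ → ℝ) (m k : ℕ) : ℝ := if k = 0 then 0 else c (k + m)

/-- The coefficient of `y^N` in `(1 - y)^{-a}`. -/
noncomputable def negBinomCoeff (a : ℝ) (N : ℕ) : ℝ :=
  (∏ j ∈ Finset.range N, (a + j)) / (N.factorial : ℝ)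

theorem succ_mul_negBinomCoeff (a : ℝ) (N : ℕ) :
    ((N : ℝ) + 1) * negBinomCoeff a (N + 1) = (a + N) * negBinomCoeff a N := by
  have : (N.factorial : ℝ) ≠ 0 := by positivity
  rw [negBinomCoeff, negBinomCoeff, Finset.prod_range_succ, Nat.factorial_succ]
  push_cast
  field_simp

theorem succ_mul_negBinomCoeff_eq_sum (a : ℝ) (N : ℕ) :
    ((N : ℝ) + 1) * negBinomCoeff a (N + 1) = a * ∑ l ∈ Finset.range (N + 1), negBinomCoeff a l := by
  rw [succ_mul_negBinomCoeff, add_mul]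
  have h : (N : ℝ) * negBinomCoeff a N = a * ∑ l ∈ Finset.range N, negBinomCoeff a l := by
    induction N with
    | zero => simp
    | succ N ih =>
      rw [Finset.sum_range_succ, mul_add, ← ih]
      push_cast
      rw [succ_mul_negBinomCoeff]
      ring
  rw [h, Finset.sum_range_succ]
  ring

theorem derivative_negBinom (a : ℝ) :
    d⁄dX (PowerSeries ℝ) (PowerSeries.mk fun N => (C (negBinomCoeff a N) : PowerSeries ℝ)) =
      (PowerSeries.mk fun _ => (C a : PowerSeries ℝ)) *
        PowerSeries.mk fun N => (C (negBinomCoeff a N) : PowerSeries ℝ) := by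
  ext1 N
  rw [coeff_derivative, coeff_mul]
  simp only [coeff_mk]
  have e : ((N : PowerSeries ℝ) + 1) = C ((N : ℝ) + 1) := by simp
  rw [e, ← map_mul, mul_comm, succ_mul_negBinomCoeff_eq_sum, map_mul, map_sum, Finset.mul_sum,
    Finset.Nat.sum_antidiagonal_eq_sum_range_succ_mk, ← Finset.sum_range_reflect]
  refine Finset.sum_congr rfl fun x _ => ?_
  simp

theorem PowerSeries.derivative_rescale {R : Type*} [CommRing R] (a : R) (F : PowerSeries R) :
    d⁄dX R (rescale a F) = C a * rescale a (d⁄dX R F) := by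
  ext n
  simp only [coeff_derivative, coeff_C_mul, coeff_rescale]
  ring

theorem PowerSeries.derivative_mul {R : Type*} [CommRing R] (F G : PowerSeries R) :
    d⁄dX R (F * G) = d⁄dX R F * G + F * d⁄dX R G := by
  rw [Derivation.leibniz, smul_eq_mul, smul_eq_mul]
  ring

theorem mk_eq_X_pow_mul_shift {c : ℕ → ℝ} {m : ℕ} (h : ∀ k < m, c k = 0) :
    PowerSeries.mk c = X ^ m * (C (c m) + PowerSeries.mk (shiftCoeff c m)) := by
  ext n
  rw [coeff_X_pow_mul', coeff_mk]
  split_ifs with hn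
  · rw [map_add, coeff_C, coeff_mk, shiftCoeff]
    obtain ⟨k, rfl⟩ := Nat.exists_eq_add_of_le hn
    rcases Nat.eq_zero_or_pos k with rfl | hk
    · simp
    · simp [hk.ne', add_comm]
  · exact h n (by omega)

/-- The factorization `G_c(x, y) = (1 - x^m y)^{-c_m} G_b(x, x^m y)` with `b_k = c_{k+m}`; both sides
solve the same differential equation in `y`. -/
theorem multisetSeries_eq_rescale {c : ℕ → ℝ} {m : ℕ} (h : ∀ k < m, c k = 0) :
    multisetSeries c = rescale ((X : PowerSeries ℝ) ^ m)
      ((PowerSeries.mk fun N => (C (negBinomCoeff (c m) N) : PowerSeries ℝ)) *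
        multisetSeries (shiftCoeff c m)) := by
  refine eq_of_derivative_eq_mul (derivative_multisetSeries c) ?_ ?_
  · rw [derivative_rescale, derivative_mul, derivative_negBinom, derivative_multisetSeries]
    have e : (PowerSeries.mk fun j : ℕ => expand (j + 1) j.succ_ne_zero (PowerSeries.mk c)) =
        C ((X : PowerSeries ℝ) ^ m) * rescale ((X : PowerSeries ℝ) ^ m)
          ((PowerSeries.mk fun _ => (C (c m) : PowerSeries ℝ)) + (PowerSeries.mk fun j : ℕ =>
            expand (j + 1) j.succ_ne_zero (PowerSeries.mk (shiftCoeff c m)))) := by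
      ext1 j
      rw [coeff_C_mul, coeff_rescale, map_add, coeff_mk, coeff_mk, coeff_mk,
        mk_eq_X_pow_mul_shift h, map_mul, map_pow, expand_X, map_add, expand_C, ← mul_assoc]
      congr 1
      ring
    rw [e, mul_assoc (C _) (rescale _ _) (rescale _ _), ← map_mul]
    congr 2
    ring
  · rw [← coeff_zero_eq_constantCoeff_apply, ← coeff_zero_eq_constantCoeff_apply,
      coeff_zero_multisetSeries, coeff_rescale, coeff_mul]
    simp [coeff_zero_multisetSeries, negBinomCoeff, -coeff_zero_eq_constantCoeff]

theorem multisetCoeff_eq_sum {c : ℕ → ℝ} {m : ℕ} (h : ∀ k < m, c k = 0) (M N : ℕ) :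
    multisetCoeff c (M + m * N) N = ∑ l ∈ Finset.range (N + 1),
      negBinomCoeff (c m) (N - l) * multisetCoeff (shiftCoeff c m) M l := by
  rw [multisetCoeff, multisetSeries_eq_rescale h, coeff_rescale, ← pow_mul, add_comm,
    coeff_X_pow_mul', if_pos (by omega), Nat.add_sub_cancel_left, mul_comm, coeff_mul, map_sum,
    Finset.Nat.sum_antidiagonal_eq_sum_range_succ_mk]
  refine Finset.sum_congr rfl fun l _ => ?_
  rw [coeff_mk, coeff_mul_C, mul_comm, multisetCoeff]

theorem coeff_multisetExponent_eq_zero {b : ℕ → ℝ} (hb : b 0 = 0) {j k : ℕ} (h : k < j) :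
    coeff k (coeff j (multisetExponent b)) = 0 := by
  rw [multisetExponent, coeff_mk, dif_neg (by omega), coeff_smul,
    X_pow_dvd_iff.1 (X_pow_dvd_expand hb j (by omega)) k h, smul_zero]

/-- The coefficient of `x^M` in `G(x, y)`, for a real number `y`. If `b 0 = 0`, this coefficient is a
polynomial in `y` of degree at most `M`, which is why the sum stops there. -/
noncomputable def evalCoeff (b : ℕ → ℝ) (y : ℝ) (M : ℕ) : ℝ :=
  ∑ l ∈ Finset.range (M + 1), multisetCoeff b M l * y ^ l

/-- The coefficient of `x^k` in `log G(x, y)`, for a real number `y`. If `b 0 = 0`, it is a polynomial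
in `y` of degree at most `k`. -/
noncomputable def logCoeff (b : ℕ → ℝ) (y : ℝ) (k : ℕ) : ℝ :=
  ∑ j ∈ Finset.range (k + 1), coeff k (coeff j (multisetExponent b)) * y ^ j

/-- The differential equation of `G = exp E` in the variable `x`, read off coefficientwise. -/
theorem succ_mul_multisetCoeff (b : ℕ → ℝ) (M l : ℕ) :
    multisetCoeff b (M + 1) l * ((M : ℝ) + 1) =
      ∑ q ∈ Finset.HasAntidiagonal.antidiagonal M, ∑ p ∈ Finset.HasAntidiagonal.antidiagonal l,
        (coeff (q.1 + 1) (coeff p.1 (multisetExponent b)) * ((q.1 : ℝ) + 1)) *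
          multisetCoeff b q.2 p.2 := by
  have h := congrArg (fun F => coeff M (coeff l F))
    (coeffwise_exp_subst (derivative ℝ) (constantCoeff_multisetExponent b))
  simp only [coeffwise, coeff_mk, coeff_mul, map_sum, coeff_derivative] at h
  rw [Finset.sum_comm]
  exact h

/-- Both sides are the values at `y` of polynomials, whose coefficients are compared in
`succ_mul_multisetCoeff`. -/
theorem succ_mul_evalCoeff {b : ℕ → ℝ} (hb : b 0 = 0) (y : ℝ) (M : ℕ) :
    evalCoeff b y (M + 1) * ((M : ℝ) + 1) =
      ∑ q ∈ Finset.HasAntidiagonal.antidiagonal M,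
        (logCoeff b y (q.1 + 1) * ((q.1 : ℝ) + 1)) * evalCoeff b y q.2 := by
  let F : ℕ → Polynomial ℝ := fun M =>
    ∑ l ∈ Finset.range (M + 1), Polynomial.monomial l (multisetCoeff b M l)
  let U : ℕ → Polynomial ℝ := fun k =>
    ∑ j ∈ Finset.range (k + 1), Polynomial.monomial j (coeff k (coeff j (multisetExponent b)))
  have hF : ∀ M l, (F M).coeff l = multisetCoeff b M l := by
    intro M l
    simp only [F, Polynomial.finsetSum_coeff, Polynomial.coeff_monomial, Finset.sum_ite_eq',
      Finset.mem_range]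
    split_ifs with h
    · rfl
    · exact (multisetCoeff_eq_zero hb (by omega)).symm
  have hU : ∀ k j, (U k).coeff j = coeff k (coeff j (multisetExponent b)) := by
    intro k j
    simp only [U, Polynomial.finsetSum_coeff, Polynomial.coeff_monomial, Finset.sum_ite_eq',
      Finset.mem_range]
    split_ifs with h
    · rfl
    · exact (coeff_multisetExponent_eq_zero hb (by omega)).symm
  have key : F (M + 1) * Polynomial.C ((M : ℝ) + 1) =
      ∑ q ∈ Finset.HasAntidiagonal.antidiagonal M,
        U (q.1 + 1) * F q.2 * Polynomial.C ((q.1 : ℝ) + 1) := by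
    ext l
    simp only [Polynomial.finsetSum_coeff, Polynomial.coeff_mul_C]
    simp only [Polynomial.coeff_mul, hF, hU, Finset.sum_mul]
    rw [succ_mul_multisetCoeff]
    exact Finset.sum_congr rfl fun q _ => Finset.sum_congr rfl fun p _ => by ring
  have h := congrArg (Polynomial.eval y) key
  simp only [F, U, Polynomial.eval_finsetSum, Polynomial.eval_mul, Polynomial.eval_C,
    Polynomial.eval_monomial] at h
  rw [evalCoeff, h]
  exact Finset.sum_congr rfl fun q _ => by rw [logCoeff, evalCoeff]; ring

theorem logCoeff_zero (b : ℕ → ℝ) (y : ℝ) : logCoeff b y 0 = 0 := by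
  simp [logCoeff, multisetExponent]

theorem evalCoeff_zero (b : ℕ → ℝ) (y : ℝ) : evalCoeff b y 0 = 1 := by
  simp [evalCoeff, multisetCoeff, coeff_zero_multisetSeries, -coeff_zero_eq_constantCoeff]

theorem mk_evalCoeff_eq_exp {b : ℕ → ℝ} (hb : b 0 = 0) (y : ℝ) :
    PowerSeries.mk (evalCoeff b y) = (exp ℝ).subst (PowerSeries.mk (logCoeff b y)) := by
  have h0 : constantCoeff (PowerSeries.mk (logCoeff b y)) = 0 := by
    rw [← coeff_zero_eq_constantCoeff_apply, coeff_mk, logCoeff_zero]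
  refine eq_of_derivative_eq_mul ?_ (derivative_exp_subst (HasSubst.of_constantCoeff_zero' h0)) ?_
  · ext M
    rw [coeff_derivative, coeff_mul]
    simp only [coeff_mk, coeff_derivative]
    exact succ_mul_evalCoeff hb y M
  · rw [constantCoeff_exp_subst h0, ← coeff_zero_eq_constantCoeff_apply, coeff_mk, evalCoeff_zero]

/-! ### The value of an exponential -/

theorem PowerSeries.hasSum_coeff_pow {t : ℕ → ℝ} {r s : ℝ} (ht : ∀ k, 0 ≤ t k) (hr : 0 ≤ r)
    (hs : HasSum (fun k => t k * r ^ k) s) (d : ℕ) :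
    HasSum (fun M => coeff M ((PowerSeries.mk t) ^ d) * r ^ M) (s ^ d) ∧
      ∀ M, 0 ≤ coeff M ((PowerSeries.mk t) ^ d) := by
  induction d with
  | zero =>
    refine ⟨?_, fun M => ?_⟩
    · convert! hasSum_single (f := fun M => coeff M ((PowerSeries.mk t) ^ 0) * r ^ M) 0 ?_ using 1
      · simp
      · intro M hM
        simp [coeff_one, hM]
    · rw [pow_zero, coeff_one]
      split_ifs <;> norm_num
  | succ d ih =>
    obtain ⟨h1, h2⟩ := ih
    refine ⟨?_, fun M => ?_⟩
    · have n1 : Summable fun M => ‖coeff M ((PowerSeries.mk t) ^ d) * r ^ M‖ := by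
        refine h1.summable.congr fun M => ?_
        rw [Real.norm_of_nonneg (mul_nonneg (h2 M) (by positivity))]
      have n2 : Summable fun M => ‖t M * r ^ M‖ := by
        refine hs.summable.congr fun M => ?_
        rw [Real.norm_of_nonneg (mul_nonneg (ht M) (by positivity))]
      have hsum := (summable_norm_sum_mul_antidiagonal_of_summable_norm n1 n2).of_norm
      have htsum := tsum_mul_tsum_eq_tsum_sum_antidiagonal_of_summable_norm n1 n2
      rw [h1.tsum_eq, hs.tsum_eq] at htsum
      rw [pow_succ s, htsum]
      convert! hsum.hasSum using 1
      ext M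
      rw [pow_succ, coeff_mul, Finset.sum_mul]
      refine Finset.sum_congr rfl fun p hp => ?_
      rw [coeff_mk, ← Finset.HasAntidiagonal.mem_antidiagonal.1 hp, pow_add]
      ring
    · rw [pow_succ, coeff_mul]
      refine Finset.sum_nonneg fun p _ => mul_nonneg (h2 _) ?_
      rw [coeff_mk]
      exact ht _

/-- Evaluation at `r` commutes with the exponential for series with non-negative coefficients, up to
and including the boundary of the disc of convergence. -/
theorem PowerSeries.hasSum_coeff_exp_subst {t : ℕ → ℝ} {r s : ℝ} (ht : ∀ k, 0 ≤ t k) (ht0 : t 0 = 0)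
    (hr : 0 ≤ r) (hs : HasSum (fun k => t k * r ^ k) s) :
    HasSum (fun M => coeff M ((exp ℝ).subst (PowerSeries.mk t)) * r ^ M) (Real.exp s) := by
  have h0 : constantCoeff (PowerSeries.mk t) = 0 := by
    rw [← coeff_zero_eq_constantCoeff_apply, coeff_mk, ht0]
  have hsub : HasSubst (PowerSeries.mk t) := HasSubst.of_constantCoeff_zero' h0
  let F : ℕ × ℕ → ℝ := fun p =>
    (1 / (p.1.factorial : ℝ)) * (coeff p.2 ((PowerSeries.mk t) ^ p.1) * r ^ p.2)
  have hF0 : ∀ p, 0 ≤ F p := fun p =>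
    mul_nonneg (by positivity) (mul_nonneg ((hasSum_coeff_pow ht hr hs p.1).2 _) (by positivity))
  have hrow : ∀ d, HasSum (fun M => F (d, M)) (1 / (d.factorial : ℝ) * s ^ d) := fun d =>
    (hasSum_coeff_pow ht hr hs d).1.mul_left _
  have hexp : HasSum (fun d : ℕ => 1 / (d.factorial : ℝ) * s ^ d) (Real.exp s) := by
    rw [Real.exp_eq_exp_ℝ]
    convert! NormedSpace.expSeries_div_hasSum_exp (𝔸 := ℝ) s using 1
    ext d
    ring
  have hsumF : Summable F := by
    rw [summable_prod_of_nonneg hF0]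
    refine ⟨fun d => (hrow d).summable, ?_⟩
    exact hexp.summable.congr fun d => (hrow d).tsum_eq.symm
  have hF : HasSum F (Real.exp s) := by
    have := hsumF.hasSum
    rwa [← (this.prod_fiberwise hrow).unique hexp]
  have hswap : HasSum (fun p : ℕ × ℕ => F p.swap) (Real.exp s) :=
    (Equiv.prodComm ℕ ℕ).hasSum_iff.2 hF
  refine hswap.prod_fiberwise fun M => ?_
  have hz : ∀ d, d ∉ Finset.range (M + 1) → coeff M ((PowerSeries.mk t) ^ d) = 0 := by
    intro d hd
    rw [Finset.mem_range, not_lt] at hd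
    exact coeff_of_lt_order _ (lt_of_lt_of_le (by exact_mod_cast hd)
      (le_order_pow_of_constantCoeff_eq_zero d h0))
  have e : coeff M ((exp ℝ).subst (PowerSeries.mk t)) =
      ∑ d ∈ Finset.range (M + 1), 1 / (d.factorial : ℝ) * coeff M ((PowerSeries.mk t) ^ d) := by
    rw [coeff_subst' hsub, finsum_eq_sum_of_support_subset]
    · refine Finset.sum_congr rfl fun d _ => ?_
      simp
    · intro d hd
      by_contra hd'
      exact hd (by simp only [hz d (by simpa using hd'), smul_zero])
  rw [e, Finset.sum_mul]
  have hfin : HasSum (fun d => F (d, M)) (∑ d ∈ Finset.range (M + 1), F (d, M)) :=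
    hasSum_sum_of_ne_finset_zero fun d hd => by simp [F, hz d hd]
  convert! hfin using 1
  exact Finset.sum_congr rfl fun d _ => by simp only [F]; ring

/-- The first `L` terms, the middle, and the last `L` terms in reverse order. -/
theorem sum_range_eq_edges_add_middle {n L : ℕ} (h : 2 * L ≤ n + 1) (f : ℕ → ℝ) :
    ∑ k ∈ Finset.range (n + 1), f k =
      ∑ k ∈ Finset.range L, f k + ∑ k ∈ Finset.Ico L (n + 1 - L), f k +
        ∑ i ∈ Finset.range L, f (n - i) := by
  have h1 : ∑ i ∈ Finset.range L, f (n - i) = ∑ k ∈ Finset.Ico (n + 1 - L) (n + 1), f k := by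
    have := Finset.sum_Ico_reflect f 0 (m := L) (n := n) (by omega)
    rw [← Finset.range_eq_Ico] at this
    simpa using this
  rw [h1, Finset.sum_range_add_sum_Ico _ (by omega), Finset.sum_range_add_sum_Ico _ (by omega)]

section ratio
variable {b : ℕ → ℝ} {ρ : ℝ}

theorem eventually_pos_of_tendsto_ratio (hb : ∀ k, 0 ≤ b k) (hρ : 0 < ρ)
    (h : Tendsto (fun n : ℕ => b n / b (n + 1)) atTop (𝓝 ρ)) : ∀ᶠ n in atTop, 0 < b n := by
  filter_upwards [h.eventually (lt_mem_nhds hρ)] with n hn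
  refine lt_of_le_of_ne (hb n) fun h0 => ?_
  rw [← h0, zero_div] at hn
  exact lt_irrefl _ hn

theorem tendsto_ratio_add (hb : ∀ k, 0 ≤ b k) (hρ : 0 < ρ)
    (h : Tendsto (fun n : ℕ => b n / b (n + 1)) atTop (𝓝 ρ)) (k : ℕ) :
    Tendsto (fun n : ℕ => b n / b (n + k)) atTop (𝓝 (ρ ^ k)) := by
  have hpos := eventually_pos_of_tendsto_ratio hb hρ h
  induction k with
  | zero =>
    rw [pow_zero]
    refine tendsto_const_nhds.congr' ?_
    filter_upwards [hpos] with n hn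
    rw [add_zero, div_self hn.ne']
  | succ k ih =>
    have h2 := h.comp (tendsto_add_atTop_nat k)
    rw [pow_succ]
    refine (ih.mul h2).congr' ?_
    filter_upwards [(tendsto_add_atTop_nat k).eventually hpos] with n hn
    simp only [Function.comp_apply]
    rw [div_mul_div_cancel₀ hn.ne', add_assoc]

theorem tendsto_ratio_sub (hb : ∀ k, 0 ≤ b k) (hρ : 0 < ρ)
    (h : Tendsto (fun n : ℕ => b n / b (n + 1)) atTop (𝓝 ρ)) (k : ℕ) :
    Tendsto (fun n : ℕ => b (n - k) / b n) atTop (𝓝 (ρ ^ k)) := by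
  rw [← tendsto_add_atTop_iff_nat k]
  simpa using tendsto_ratio_add hb hρ h k

/-- In the convolution square of `b`, the terms in which both indices are large are negligible
against `b n`. -/
def MiddleNegligible (b : ℕ → ℝ) : Prop :=
  ∀ ε > 0, ∃ L₀, ∀ L ≥ L₀, ∀ᶠ n in atTop,
    ∑ k ∈ Finset.Ico L (n + 1 - L), b k * b (n - k) ≤ ε * b n

/-- The edge terms with index below `L` contribute `2 ∑_{k < L} b_k ρ^k` in the limit, which exhausts
the full limit `2 B(ρ)` as `L → ∞`. -/
theorem IsSubexponential.middleNegligible (hb : IsSubexponential b ρ) : MiddleNegligible b := by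
  intro ε hε
  have hpos := eventually_pos_of_tendsto_ratio hb.nonneg hb.radius_pos hb.tendsto_ratio
  have hpart := hb.summable.hasSum.tendsto_sum_nat
  have hL := hpart.eventually (lt_mem_nhds (show seriesValue b ρ - ε / 2 < ∑' k, b k * ρ ^ k by
    rw [seriesValue]; linarith))
  obtain ⟨L₀, hL₀⟩ := eventually_atTop.1 hL
  refine ⟨L₀, fun L hL => ?_⟩
  have hedge : Tendsto (fun n => ∑ k ∈ Finset.range L, b k * (b (n - k) / b n)) atTop
      (𝓝 (∑ k ∈ Finset.range L, b k * ρ ^ k)) :=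
    tendsto_finsetSum _ fun k _ =>
      (tendsto_ratio_sub hb.nonneg hb.radius_pos hb.tendsto_ratio k).const_mul _
  have hdiff := hb.tendsto_conv.sub (hedge.const_mul 2)
  have hlt : 2 * seriesValue b ρ - 2 * ∑ k ∈ Finset.range L, b k * ρ ^ k < ε := by
    have := hL₀ L hL
    linarith
  filter_upwards [hdiff.eventually (gt_mem_nhds hlt), hpos, eventually_ge_atTop (2 * L)]
    with n hn hbn hnL
  rw [sum_range_eq_edges_add_middle (by omega : 2 * L ≤ n + 1)] at hn
  have e1 : ∑ i ∈ Finset.range L, b (n - i) * b (n - (n - i)) =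
      ∑ k ∈ Finset.range L, b k * b (n - k) := by
    refine Finset.sum_congr rfl fun i hi => ?_
    rw [Nat.sub_sub_self (by have := Finset.mem_range.1 hi; omega), mul_comm]
  have e2 : ∑ k ∈ Finset.range L, b k * (b (n - k) / b n) =
      (∑ k ∈ Finset.range L, b k * b (n - k)) / b n := by
    rw [Finset.sum_div]
    exact Finset.sum_congr rfl fun i _ => by ring
  rw [e1, e2, add_div, add_div] at hn
  rw [← div_le_iff₀ hbn]
  linarith

/-- The middle of the convolution square of the shifted sequence at `n` is a middle of the original
one at `n + 2 m`. -/
theorem MiddleNegligible.shift (hb : ∀ k, 0 ≤ b k) (hρ : 0 < ρ)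
    (h : Tendsto (fun n : ℕ => b n / b (n + 1)) atTop (𝓝 ρ)) (hmid : MiddleNegligible b) (m : ℕ) :
    MiddleNegligible (shiftCoeff b m) := by
  intro ε hε
  have hpos := eventually_pos_of_tendsto_ratio hb hρ h
  obtain ⟨L₀, hL₀⟩ := hmid (ε * ρ ^ m / 2) (by positivity)
  refine ⟨L₀ + 1, fun L hL => ?_⟩
  have hr := ((tendsto_ratio_add hb hρ h m).comp (tendsto_add_atTop_nat m)).eventually
    (lt_mem_nhds (show ρ ^ m / 2 < ρ ^ m by have := pow_pos hρ m; linarith))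
  filter_upwards [(tendsto_add_atTop_nat (2 * m)).eventually (hL₀ (L + m) (by omega)), hr,
    (tendsto_add_atTop_nat (2 * m)).eventually hpos, eventually_ge_atTop (2 * L),
    eventually_ge_atTop 1] with n hn hr hp hnL hn1
  have e : ∑ k ∈ Finset.Ico L (n + 1 - L), shiftCoeff b m k * shiftCoeff b m (n - k) =
      ∑ k ∈ Finset.Ico (L + m) (n + 2 * m + 1 - (L + m)), b k * b (n + 2 * m - k) := by
    rw [show n + 2 * m + 1 - (L + m) = (n + 1 - L) + m by omega, ← Finset.sum_Ico_add']
    refine Finset.sum_congr rfl fun k hk => ?_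
    have hk := Finset.mem_Ico.1 hk
    rw [shiftCoeff, shiftCoeff, if_neg (by omega), if_neg (by omega)]
    congr 2
    omega
  rw [e, shiftCoeff, if_neg (by omega)]
  refine hn.trans ?_
  simp only [Function.comp_apply] at hr
  rw [show n + m + m = n + 2 * m by ring, lt_div_iff₀ hp] at hr
  calc ε * ρ ^ m / 2 * b (n + 2 * m) = ε * (ρ ^ m / 2 * b (n + 2 * m)) := by ring
    _ ≤ ε * b (n + m) := by gcongr

end ratio

/-! ### One-variable asymptotics from the recurrence -/

section recurrence

variable {b t g : ℕ → ℝ} {ρ τ : ℝ}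

/-- In `n g_n = ∑ k t_k g_{n-k}`, the terms in which `g` has index at least `L` are bounded through
a bound `g ≤ K b` on the earlier values. -/
theorem recurrence_remainder_bounds (ht : ∀ k, 0 ≤ t k) (hg : ∀ k, 0 ≤ g k)
    (hb : ∀ k, 0 ≤ b k)
    (hrec : ∀ n : ℕ, (n : ℝ) * g n = ∑ k ∈ Finset.range (n + 1), (k : ℝ) * t k * g (n - k))
    {L n : ℕ} {K T : ℝ} (hT0 : 0 ≤ T) (hL : 1 ≤ L) (hn : 2 * L ≤ n)
    (hT : ∀ k, L ≤ k → t k ≤ T * b k) (hK : ∀ i, L ≤ i → i < n → g i ≤ K * b i) :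
    0 ≤ n * g n - ∑ i ∈ Finset.range L, ((n - i : ℕ) : ℝ) * t (n - i) * g i ∧
      n * g n - ∑ i ∈ Finset.range L, ((n - i : ℕ) : ℝ) * t (n - i) * g i ≤
        K * ∑ k ∈ Finset.range L, (k : ℝ) * t k * b (n - k) +
          n * (T * K * ∑ k ∈ Finset.Ico L (n + 1 - L), b k * b (n - k)) := by
  have hnn : ∀ k : ℕ, 0 ≤ (k : ℝ) * t k * g (n - k) := fun k =>
    mul_nonneg (mul_nonneg (by positivity) (ht k)) (hg _)
  have e1 : ∑ i ∈ Finset.range L, ((n - i : ℕ) : ℝ) * t (n - i) * g (n - (n - i)) =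
      ∑ i ∈ Finset.range L, ((n - i : ℕ) : ℝ) * t (n - i) * g i := by
    refine Finset.sum_congr rfl fun i hi => ?_
    rw [Nat.sub_sub_self (by have := Finset.mem_range.1 hi; omega)]
  rw [hrec n, sum_range_eq_edges_add_middle (by omega : 2 * L ≤ n + 1), e1, add_sub_cancel_right]
  refine ⟨add_nonneg (Finset.sum_nonneg fun k _ => hnn k) (Finset.sum_nonneg fun k _ => hnn k), ?_⟩
  refine add_le_add ?_ ?_
  · rw [Finset.mul_sum]
    refine Finset.sum_le_sum fun k hk => ?_
    have hk := Finset.mem_range.1 hk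
    rcases Nat.eq_zero_or_pos k with rfl | hk0
    · simp
    · calc (k : ℝ) * t k * g (n - k) ≤ (k : ℝ) * t k * (K * b (n - k)) :=
            mul_le_mul_of_nonneg_left (hK _ (by omega) (by omega))
              (mul_nonneg (by positivity) (ht k))
        _ = K * ((k : ℝ) * t k * b (n - k)) := by ring
  · rw [Finset.mul_sum, Finset.mul_sum]
    refine Finset.sum_le_sum fun k hk => ?_
    have hk := Finset.mem_Ico.1 hk
    have hkn : (k : ℝ) ≤ n := by exact_mod_cast (by omega : k ≤ n)
    calc (k : ℝ) * t k * g (n - k) ≤ ((n : ℝ) * (T * b k)) * (K * b (n - k)) := by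
          refine mul_le_mul (mul_le_mul hkn (hT k (by omega)) (ht k) (by positivity))
            (hK _ (by omega) (by omega)) (hg _) ?_
          exact mul_nonneg (by positivity) (mul_nonneg hT0 (hb k))
      _ = n * (T * K * (b k * b (n - k))) := by ring

/-- Strong induction on `n`: by `recurrence_remainder_bounds`, a bound `K` for earlier values gives
`g_n / b_n ≤ K / 4 + K / 4 + O(1)`, where the `O(1)` comes from finitely many values of `g` and does
not depend on `K`. -/
theorem exists_le_mul_of_recurrence (hb : ∀ k, 0 ≤ b k) (hρ : 0 < ρ)
    (hratio : Tendsto (fun n : ℕ => b n / b (n + 1)) atTop (𝓝 ρ)) (hmid : MiddleNegligible b)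
    (ht : ∀ k, 0 ≤ t k) (hlim : Tendsto (fun n => t n / b n) atTop (𝓝 τ))
    (hg : ∀ k, 0 ≤ g k)
    (hrec : ∀ n : ℕ, (n : ℝ) * g n = ∑ k ∈ Finset.range (n + 1), (k : ℝ) * t k * g (n - k)) :
    ∃ K, 0 ≤ K ∧ ∀ᶠ n in atTop, g n ≤ K * b n := by
  have hpos := eventually_pos_of_tendsto_ratio hb hρ hratio
  have hτ : 0 ≤ τ := ge_of_tendsto' hlim fun n => div_nonneg (ht n) (hb n)
  obtain ⟨T, hTdef⟩ : ∃ T, T = τ + 1 := ⟨_, rfl⟩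
  have hT0 : 0 < T := by rw [hTdef]; linarith
  have htT : ∀ᶠ n in atTop, t n ≤ T * b n := by
    filter_upwards [hpos, hlim.eventually (gt_mem_nhds (show τ < T by rw [hTdef]; linarith))]
      with n hn h
    exact ((div_lt_iff₀ hn).1 h).le
  obtain ⟨L₀, hL₀⟩ := hmid (1 / (4 * T)) (by positivity)
  obtain ⟨L₁, hL₁⟩ := eventually_atTop.1 (hpos.and htT)
  set L := max (max L₀ L₁) 1 with hLdef
  have hLL0 : L₀ ≤ L := le_trans (le_max_left _ _) (le_max_left _ _)
  have hLL1 : L₁ ≤ L := le_trans (le_max_right _ _) (le_max_left _ _)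
  have hL1 : 1 ≤ L := le_max_right _ _
  obtain ⟨R, hR0, hR⟩ : ∃ R : ℝ, 0 < R ∧ ∀ᶠ n in atTop, ∀ i ∈ Finset.range L,
      b (n - i) ≤ R * b n := by
    refine ⟨∑ i ∈ Finset.range L, (ρ ^ i + 1), ?_, ?_⟩
    · exact Finset.sum_pos (fun i _ => by positivity) (by simpa using by omega)
    · rw [eventually_all_finset]
      intro i hi
      filter_upwards [hpos, (tendsto_ratio_sub hb hρ hratio i).eventually
        (gt_mem_nhds (show ρ ^ i < ρ ^ i + 1 by linarith))] with n hn h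
      refine ((div_lt_iff₀ hn).1 h).le.trans (mul_le_mul_of_nonneg_right ?_ hn.le)
      exact Finset.single_le_sum (f := fun i => ρ ^ i + 1) (fun i _ => by positivity) hi
  set S₁ := ∑ k ∈ Finset.range L, (k : ℝ) * t k with hS₁
  set S₂ := ∑ i ∈ Finset.range L, g i with hS₂
  have hS₁0 : 0 ≤ S₁ := Finset.sum_nonneg fun k _ => mul_nonneg (by positivity) (ht k)
  have hS₂0 : 0 ≤ S₂ := Finset.sum_nonneg fun k _ => hg k
  have hlarge : ∀ᶠ n : ℕ in atTop, 4 * R * S₁ ≤ n :=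
    tendsto_natCast_atTop_atTop.eventually_ge_atTop _
  obtain ⟨n₁, hn₁⟩ := eventually_atTop.1 (((hL₀ L hLL0).and hR).and
    (hlarge.and (eventually_ge_atTop (2 * L))))
  -- the first summand serves the start of the induction, the second the terms with `g i`, `i < L`
  set K := ∑ i ∈ Finset.range n₁, g i / b i + 2 * T * R * S₂ with hKdef
  have hsum0 : 0 ≤ ∑ i ∈ Finset.range n₁, g i / b i :=
    Finset.sum_nonneg fun i _ => div_nonneg (hg i) (hb i)
  have hTRS : 0 ≤ 2 * T * R * S₂ := by positivity
  have hK0 : 0 ≤ K := add_nonneg hsum0 hTRS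
  refine ⟨K, hK0, eventually_atTop.2 ⟨L, ?_⟩⟩
  intro n
  induction n using Nat.strong_induction_on with
  | _ n ih =>
    intro hLn
    have hbn : 0 < b n := (hL₁ n (by omega)).1
    by_cases hnn : n < n₁
    · rw [← div_le_iff₀ hbn]
      have := Finset.single_le_sum (f := fun i => g i / b i)
        (fun i _ => div_nonneg (hg i) (hb i)) (Finset.mem_range.2 hnn)
      linarith
    · obtain ⟨⟨hmidn, hRn⟩, hlargen, h2L⟩ := hn₁ n (by omega)
      have hn0 : (0 : ℝ) < n := by exact_mod_cast (by omega : 0 < n)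
      have hest := (recurrence_remainder_bounds ht hg hb hrec hT0.le hL1 h2L
        (fun k hk => (hL₁ k (by omega)).2) (fun i hi hin => ih i hin hi)).2
      have h1 : ∑ i ∈ Finset.range L, ((n - i : ℕ) : ℝ) * t (n - i) * g i ≤
          n * (T * R * S₂ * b n) := by
        rw [hS₂, Finset.mul_sum, Finset.sum_mul, Finset.mul_sum]
        refine Finset.sum_le_sum fun i hi => ?_
        have hi' := Finset.mem_range.1 hi
        have a1 : t (n - i) ≤ T * (R * b n) := (hL₁ (n - i) (by omega)).2.trans
          (mul_le_mul_of_nonneg_left (hRn i hi) hT0.le)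
        have a2 : ((n - i : ℕ) : ℝ) ≤ n := by exact_mod_cast Nat.sub_le _ _
        calc ((n - i : ℕ) : ℝ) * t (n - i) * g i ≤ n * (T * (R * b n)) * g i :=
              mul_le_mul_of_nonneg_right (mul_le_mul a2 a1 (ht _) hn0.le) (hg i)
          _ = n * (T * R * g i * b n) := by ring
      have h2 : ∑ k ∈ Finset.range L, (k : ℝ) * t k * b (n - k) ≤ S₁ * (R * b n) := by
        rw [hS₁, Finset.sum_mul]
        exact Finset.sum_le_sum fun k hk =>
          mul_le_mul_of_nonneg_left (hRn k hk) (mul_nonneg (by positivity) (ht k))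
      have h3 : K * ∑ k ∈ Finset.range L, (k : ℝ) * t k * b (n - k) ≤ n * (K / 4 * b n) := by
        calc _ ≤ K * (S₁ * (R * b n)) := mul_le_mul_of_nonneg_left h2 hK0
          _ = (4 * R * S₁) * (K / 4 * b n) := by ring
          _ ≤ n * (K / 4 * b n) := mul_le_mul_of_nonneg_right hlargen (by positivity)
      have h4 : T * K * ∑ k ∈ Finset.Ico L (n + 1 - L), b k * b (n - k) ≤ K / 4 * b n := by
        calc _ ≤ T * K * (1 / (4 * T) * b n) := mul_le_mul_of_nonneg_left hmidn (by positivity)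
          _ = K / 4 * b n := by field_simp
      have h5 : T * R * S₂ * b n ≤ K / 2 * b n :=
        mul_le_mul_of_nonneg_right (by rw [hKdef]; linarith) hbn.le
      have h6 := mul_le_mul_of_nonneg_left h4 hn0.le
      have h7 := mul_le_mul_of_nonneg_left h5 hn0.le
      refine le_of_mul_le_mul_left (?_ : (n : ℝ) * g n ≤ n * (K * b n)) hn0
      calc (n : ℝ) * g n ≤ n * (K / 4 * b n) + n * (K / 4 * b n) + n * (K / 2 * b n) := by linarith
        _ = n * (K * b n) := by ring

theorem summable_of_recurrence (hg : ∀ k, 0 ≤ g k) (hρ : 0 < ρ)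
    (hsum : Summable fun k => b k * ρ ^ k) {K : ℝ} (hK : ∀ᶠ n in atTop, g n ≤ K * b n) :
    Summable fun k => g k * ρ ^ k := by
  refine Summable.of_norm_bounded_eventually_nat (hsum.mul_left K) ?_
  filter_upwards [hK] with n hn
  rw [Real.norm_of_nonneg (mul_nonneg (hg n) (by positivity)), ← mul_assoc]
  exact mul_le_mul_of_nonneg_right hn (by positivity)

theorem tendsto_div_of_recurrence (hb : ∀ k, 0 ≤ b k) (hρ : 0 < ρ)
    (hratio : Tendsto (fun n : ℕ => b n / b (n + 1)) atTop (𝓝 ρ)) (hmid : MiddleNegligible b)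
    (hsum : Summable fun k => b k * ρ ^ k)
    (ht : ∀ k, 0 ≤ t k) (hlim : Tendsto (fun n => t n / b n) atTop (𝓝 τ))
    (hg : ∀ k, 0 ≤ g k)
    (hrec : ∀ n : ℕ, (n : ℝ) * g n = ∑ k ∈ Finset.range (n + 1), (k : ℝ) * t k * g (n - k)) :
    Tendsto (fun n => g n / b n) atTop (𝓝 (τ * ∑' k, g k * ρ ^ k)) := by
  have hpos := eventually_pos_of_tendsto_ratio hb hρ hratio
  have hτ : 0 ≤ τ := ge_of_tendsto' hlim fun n => div_nonneg (ht n) (hb n)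
  obtain ⟨K, hK0, hK⟩ := exists_le_mul_of_recurrence hb hρ hratio hmid ht hlim hg hrec
  have hgs := summable_of_recurrence hg hρ hsum hK
  obtain ⟨T, hTdef⟩ : ∃ T, T = τ + 1 := ⟨_, rfl⟩
  have hT0 : 0 < T := by rw [hTdef]; linarith
  have htT : ∀ᶠ n in atTop, t n ≤ T * b n := by
    filter_upwards [hpos, hlim.eventually (gt_mem_nhds (show τ < T by rw [hTdef]; linarith))]
      with n hn h
    exact ((div_lt_iff₀ hn).1 h).le
  -- the terms in which `g` has index below a fixed `L`
  have hratio_i : ∀ i, Tendsto (fun n => b (n - i) / b n) atTop (𝓝 (ρ ^ i)) :=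
    tendsto_ratio_sub hb hρ hratio
  have hfrac : ∀ i : ℕ, Tendsto (fun n : ℕ => ((n - i : ℕ) : ℝ) / n) atTop (𝓝 1) := by
    intro i
    rw [← tendsto_add_atTop_iff_nat i]
    simpa using tendsto_natCast_div_add_atTop (𝕜 := ℝ) (i : ℝ)
  have hedge : ∀ L, Tendsto (fun n : ℕ => ∑ i ∈ Finset.range L,
      ((n - i : ℕ) : ℝ) / n * (t (n - i) / b (n - i) * (b (n - i) / b n)) * g i) atTop
      (𝓝 (τ * ∑ i ∈ Finset.range L, g i * ρ ^ i)) := by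
    intro L
    rw [Finset.mul_sum]
    refine tendsto_finsetSum _ fun i _ => ?_
    have h := ((hfrac i).mul ((hlim.comp (tendsto_sub_atTop_nat i)).mul (hratio_i i))).mul_const
      (g i)
    convert! h using 2
    ring
  rw [Metric.tendsto_atTop']
  intro ε hε
  -- `T * K + 1` avoids a division by zero when `K = 0`
  obtain ⟨L₀, hL₀⟩ := hmid (ε / (4 * (T * K + 1))) (by positivity)
  obtain ⟨L₁, hL₁⟩ := eventually_atTop.1 ((hpos.and htT).and hK)
  obtain ⟨L₂, hL₂⟩ := eventually_atTop.1 ((hgs.hasSum.tendsto_sum_nat.const_mul τ).eventually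
    (Metric.ball_mem_nhds _ (show 0 < ε / 4 by positivity)))
  obtain ⟨L, hLL0, hLL1, hLL2, hL1⟩ : ∃ L, L₀ ≤ L ∧ L₁ ≤ L ∧ L₂ ≤ L ∧ 1 ≤ L :=
    ⟨L₀ + L₁ + L₂ + 1, by omega, by omega, by omega, by omega⟩
  have hsmall : Tendsto (fun n : ℕ => K * (∑ k ∈ Finset.range L,
      (k : ℝ) * t k * (b (n - k) / b n)) / (n : ℝ)) atTop (𝓝 0) :=
    ((tendsto_finsetSum _ fun k _ => (hratio_i k).const_mul _).const_mul K).div_atTop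
      tendsto_natCast_atTop_atTop
  obtain ⟨N, hN⟩ := eventually_atTop.1 (((hL₀ L hLL0).and
    (hsmall.eventually (gt_mem_nhds (show 0 < ε / 4 by positivity)))).and
    (((hedge L).eventually (Metric.ball_mem_nhds _ (show 0 < ε / 4 by positivity))).and
      (eventually_ge_atTop (2 * L))))
  refine ⟨N, fun n hn => ?_⟩
  obtain ⟨⟨hmidn, hsm⟩, hed, h2L⟩ := hN n hn.le
  have hbn : 0 < b n := (hL₁ n (by omega)).1.1
  have hn0 : (0 : ℝ) < n := by exact_mod_cast (by omega : 0 < n)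
  obtain ⟨hlo, hhi⟩ := recurrence_remainder_bounds ht hg hb hrec hT0.le hL1 h2L
    (fun k hk => (hL₁ k (by omega)).1.2) (fun i hi _ => (hL₁ i (by omega)).2)
  have hl2 := hL₂ L hLL2
  rw [Real.dist_eq] at hl2 hed ⊢
  set A := ∑ i ∈ Finset.range L, ((n - i : ℕ) : ℝ) * t (n - i) * g i with hA
  have eA : ∑ i ∈ Finset.range L,
      ((n - i : ℕ) : ℝ) / n * (t (n - i) / b (n - i) * (b (n - i) / b n)) * g i =
      A / (n * b n) := by
    rw [hA, Finset.sum_div]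
    refine Finset.sum_congr rfl fun i hi => ?_
    have hi' := Finset.mem_range.1 hi
    have : b (n - i) ≠ 0 := (hL₁ (n - i) (by omega)).1.1.ne'
    field_simp
  rw [eA] at hed
  have e2 : g n / b n - A / (n * b n) = (n * g n - A) / (n * b n) := by field_simp
  have hlo' : 0 ≤ g n / b n - A / (n * b n) := by
    rw [e2]; exact div_nonneg hlo (by positivity)
  have hhi' : g n / b n - A / (n * b n) ≤ ε / 4 + ε / 4 := by
    rw [e2]
    refine (div_le_div_of_nonneg_right hhi (by positivity)).trans ?_
    rw [add_div]
    refine add_le_add ?_ ?_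
    · refine le_trans (le_of_eq ?_) hsm.le
      rw [Finset.mul_sum, Finset.mul_sum, Finset.sum_div, Finset.sum_div]
      exact Finset.sum_congr rfl fun k _ => by field_simp
    · rw [mul_div_mul_left _ _ hn0.ne', div_le_iff₀ hbn]
      have hTK : 0 ≤ T * K := by positivity
      refine (mul_le_mul_of_nonneg_left hmidn hTK).trans ?_
      rw [← mul_assoc]
      refine mul_le_mul_of_nonneg_right ?_ hbn.le
      rw [mul_div_assoc', div_le_div_iff₀ (by positivity) (by norm_num)]
      nlinarith
  rw [abs_lt] at hl2 hed ⊢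
  constructor <;> linarith

end recurrence

/-! ### The logarithm of the multiset series at a real `y` -/

theorem coeff_coeff_succ_multisetExponent (b : ℕ → ℝ) (j k : ℕ) :
    coeff k (coeff (j + 1) (multisetExponent b)) =
      (1 / ((j + 1 : ℕ) : ℝ)) * if (j + 1) ∣ k then b (k / (j + 1)) else 0 := by
  rw [multisetExponent, coeff_mk, dif_neg j.succ_ne_zero, coeff_smul, coeff_expand, smul_eq_mul]
  simp only [coeff_mk]

theorem coeff_zero_multisetExponent (b : ℕ → ℝ) : coeff 0 (multisetExponent b) = 0 := by
  rw [coeff_zero_eq_constantCoeff_apply, constantCoeff_multisetExponent]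

theorem coeff_coeff_multisetExponent_nonneg {b : ℕ → ℝ} (hb : ∀ k, 0 ≤ b k) (j k : ℕ) :
    0 ≤ coeff k (coeff j (multisetExponent b)) := by
  cases j with
  | zero => simp [coeff_zero_multisetExponent, -coeff_zero_eq_constantCoeff]
  | succ j =>
    rw [coeff_coeff_succ_multisetExponent]
    refine mul_nonneg (by positivity) ?_
    split_ifs
    · exact hb _
    · rfl

theorem logCoeff_nonneg {b : ℕ → ℝ} (hb : ∀ k, 0 ≤ b k) {y : ℝ} (hy : 0 ≤ y) (k : ℕ) :
    0 ≤ logCoeff b y k :=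
  Finset.sum_nonneg fun j _ =>
    mul_nonneg (coeff_coeff_multisetExponent_nonneg hb j k) (by positivity)

theorem evalCoeff_nonneg {b : ℕ → ℝ} (hb : ∀ k, 0 ≤ b k) {y : ℝ} (hy : 0 ≤ y) (M : ℕ) :
    0 ≤ evalCoeff b y M :=
  Finset.sum_nonneg fun l _ => mul_nonneg (multisetCoeff_nonneg hb M l) (by positivity)

/-- The terms `j ≥ 2` of `log G(x, y)` at `x^k`, with `i j = k`, satisfy
`b_i y^j ≤ S σ^{-(2 i + j)} ≤ S σ^{-(k + 2)}`, because `(i - 1) (j - 2) ≥ 0`. -/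
theorem abs_logCoeff_sub_le {b : ℕ → ℝ} (hb0 : b 0 = 0) (hb : ∀ k, 0 ≤ b k) {σ y S : ℝ}
    (hσ : 0 < σ) (hσ1 : σ ≤ 1) (hy : 0 ≤ y) (hyσ : y ≤ σ⁻¹)
    (hS : ∀ i, b i ≤ S * (σ⁻¹ ^ 2) ^ i) {k : ℕ} (hk : 1 ≤ k) :
    |logCoeff b y k - y * b k| ≤ k * (S * σ⁻¹ ^ (k + 2)) := by
  obtain ⟨n, rfl⟩ : ∃ n, k = n + 1 := ⟨k - 1, by omega⟩
  have hσ' : 1 ≤ σ⁻¹ := (one_le_inv₀ hσ).2 hσ1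
  have hS0 : 0 ≤ S := by simpa [hb0] using hS 0
  have e : logCoeff b y (n + 1) - y * b (n + 1) =
      ∑ j ∈ Finset.range n, coeff (n + 1) (coeff (j + 1 + 1) (multisetExponent b)) *
        y ^ (j + 1 + 1) := by
    rw [logCoeff, Finset.sum_range_succ', Finset.sum_range_succ', coeff_zero_multisetExponent,
      coeff_coeff_succ_multisetExponent]
    simp
    ring
  have hterm : ∀ j, coeff (n + 1) (coeff (j + 1 + 1) (multisetExponent b)) * y ^ (j + 1 + 1) ≤
      S * σ⁻¹ ^ (n + 1 + 2) := by
    intro j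
    rw [coeff_coeff_succ_multisetExponent]
    split_ifs with hd
    · obtain ⟨i, hi⟩ := hd
      have hi0 : 1 ≤ i := by
        by_contra h
        have : i = 0 := by omega
        simp [this] at hi
      have hexp : 2 * i + (j + 1 + 1) ≤ n + 1 + 2 := by
        rw [hi]
        obtain ⟨i', rfl⟩ : ∃ i', i = i' + 1 := ⟨i - 1, by omega⟩
        nlinarith [Nat.zero_le (i' * j)]
      rw [hi, Nat.mul_div_cancel_left _ (by omega), ← hi]
      have h1 : 1 / ((j + 1 + 1 : ℕ) : ℝ) ≤ 1 := by
        rw [div_le_one (by positivity)]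
        exact_mod_cast (by omega : 1 ≤ j + 1 + 1)
      calc 1 / ((j + 1 + 1 : ℕ) : ℝ) * b i * y ^ (j + 1 + 1)
          ≤ 1 * (S * (σ⁻¹ ^ 2) ^ i) * σ⁻¹ ^ (j + 1 + 1) := by
            refine mul_le_mul (mul_le_mul h1 (hS i) (hb i) zero_le_one)
              (pow_le_pow_left₀ hy hyσ _) (by positivity) (by positivity)
        _ = S * σ⁻¹ ^ (2 * i + (j + 1 + 1)) := by rw [pow_add _ (2 * i), pow_mul]; ring
        _ ≤ S * σ⁻¹ ^ (n + 1 + 2) := by gcongr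
    · rw [mul_zero, zero_mul]
      positivity
  rw [e, abs_of_nonneg (Finset.sum_nonneg fun j _ =>
    mul_nonneg (coeff_coeff_multisetExponent_nonneg hb _ _) (by positivity))]
  refine (Finset.sum_le_card_nsmul _ _ _ fun j _ => hterm j).trans ?_
  rw [Finset.card_range, nsmul_eq_mul]
  refine mul_le_mul_of_nonneg_right ?_ (by positivity)
  exact_mod_cast Nat.le_succ n

/-- As `b_n` grows like `σ^{-2n}` up to subexponential factors, it dominates `n σ^{-n}`. -/
theorem tendsto_mul_pow_div {b : ℕ → ℝ} (hb : ∀ k, 0 ≤ b k) {σ : ℝ} (hσ : 0 < σ) (hσ1 : σ < 1)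
    (hratio : Tendsto (fun n : ℕ => b n / b (n + 1)) atTop (𝓝 (σ ^ 2))) :
    Tendsto (fun n : ℕ => (n : ℝ) * σ⁻¹ ^ n / b n) atTop (𝓝 0) := by
  have hpos := eventually_pos_of_tendsto_ratio hb (by positivity) hratio
  have hs : Summable fun n : ℕ => (n : ℝ) * σ⁻¹ ^ n / b n := by
    refine summable_of_ratio_test_tendsto_lt_one (l := σ) hσ1 ?_ ?_
    · filter_upwards [hpos, eventually_ge_atTop 1] with n hn hn1
      have : (0 : ℝ) < n := by exact_mod_cast hn1
      positivity
    · have h1 : Tendsto (fun n : ℕ => 1 + 1 / (n : ℝ)) atTop (𝓝 (1 + 0)) :=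
        tendsto_const_nhds.add (tendsto_const_div_atTop_nhds_zero_nat 1)
      have h2 := (h1.mul_const σ⁻¹).mul hratio
      have e : (1 + 0) * σ⁻¹ * σ ^ 2 = σ := by field_simp; norm_num
      rw [e] at h2
      refine h2.congr' ?_
      filter_upwards [hpos, (tendsto_add_atTop_nat 1).eventually hpos, eventually_ge_atTop 1]
        with n hn hn' hn1
      have hn0 : (0 : ℝ) < n := by exact_mod_cast hn1
      rw [Real.norm_of_nonneg (by positivity), Real.norm_of_nonneg (by positivity)]
      rw [pow_succ]
      push_cast
      field_simp
  exact hs.tendsto_atTop_zero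

theorem tendsto_logCoeff_div {b : ℕ → ℝ} (hb0 : b 0 = 0) (hb : ∀ k, 0 ≤ b k) {σ y : ℝ}
    (hσ : 0 < σ) (hσ1 : σ < 1) (hy : 0 ≤ y) (hyσ : y ≤ σ⁻¹)
    (hratio : Tendsto (fun n : ℕ => b n / b (n + 1)) atTop (𝓝 (σ ^ 2)))
    (hsum : Summable fun k => b k * (σ ^ 2) ^ k) :
    Tendsto (fun n => logCoeff b y n / b n) atTop (𝓝 y) := by
  have hpos := eventually_pos_of_tendsto_ratio hb (by positivity) hratio
  set S := ∑' k, b k * (σ ^ 2) ^ k with hSdef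
  have hS : ∀ i, b i ≤ S * (σ⁻¹ ^ 2) ^ i := by
    intro i
    have h := hsum.le_tsum i fun j _ => mul_nonneg (hb j) (by positivity)
    rw [inv_pow, inv_pow, ← div_eq_mul_inv, le_div_iff₀ (by positivity)]
    exact h
  have h0 := (tendsto_mul_pow_div hb hσ hσ1 hratio).const_mul (S * σ⁻¹ ^ 2)
  rw [mul_zero] at h0
  rw [tendsto_iff_norm_sub_tendsto_zero]
  refine squeeze_zero' (Eventually.of_forall fun _ => norm_nonneg _) ?_ h0
  filter_upwards [hpos, eventually_ge_atTop 1] with n hn hn1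
  have h := abs_logCoeff_sub_le hb0 hb hσ hσ1.le hy hyσ hS hn1
  have e : logCoeff b y n / b n - y = (logCoeff b y n - y * b n) / b n := by field_simp
  rw [e, Real.norm_eq_abs, abs_div, abs_of_pos hn, div_le_iff₀ hn]
  refine h.trans (le_of_eq ?_)
  rw [mul_div_assoc', div_mul_cancel₀ _ hn.ne', pow_add]
  ring

theorem summable_mul_pow_pow {b : ℕ → ℝ} (hb : ∀ k, 0 ≤ b k) {ρ : ℝ} (hρ : 0 < ρ) (hρ1 : ρ < 1)
    (hsum : Summable fun k => b k * ρ ^ k) {j : ℕ} (hj : 1 ≤ j) :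
    Summable fun k => b k * (ρ ^ j) ^ k := by
  refine Summable.of_nonneg_of_le (fun k => mul_nonneg (hb k) (by positivity)) (fun k => ?_) hsum
  exact mul_le_mul_of_nonneg_left
    (pow_le_pow_left₀ (by positivity) (pow_le_of_le_one hρ.le hρ1.le (by omega)) k) (hb k)

theorem seriesValue_pow_le {b : ℕ → ℝ} (hb0 : b 0 = 0) (hb : ∀ k, 0 ≤ b k) {ρ : ℝ} (hρ : 0 < ρ)
    (hρ1 : ρ < 1) (hsum : Summable fun k => b k * ρ ^ k) (j : ℕ) :
    seriesValue b (ρ ^ (j + 1)) ≤ ρ ^ j * seriesValue b ρ := by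
  rw [seriesValue, seriesValue, ← tsum_mul_left]
  refine (summable_mul_pow_pow hb hρ hρ1 hsum (by omega)).tsum_le_tsum (fun k => ?_)
    (hsum.mul_left _)
  rcases Nat.eq_zero_or_pos k with rfl | hk
  · simp [hb0]
  · rw [mul_left_comm, ← pow_add, ← pow_mul]
    refine mul_le_mul_of_nonneg_left (pow_le_pow_of_le_one hρ.le hρ1.le ?_) (hb k)
    nlinarith [Nat.zero_le (j * (k - 1)), Nat.sub_add_cancel hk]

theorem summable_seriesValue_pow {b : ℕ → ℝ} (hb0 : b 0 = 0) (hb : ∀ k, 0 ≤ b k) {ρ : ℝ}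
    (hρ : 0 < ρ) (hρ1 : ρ < 1) (hsum : Summable fun k => b k * ρ ^ k) :
    Summable fun j : ℕ => 1 / ((j + 1 : ℕ) : ℝ) * seriesValue b (ρ ^ (j + 1)) := by
  have h0 : ∀ j : ℕ, 0 ≤ seriesValue b (ρ ^ (j + 1)) := fun j =>
    tsum_nonneg fun k => mul_nonneg (hb k) (by positivity)
  refine Summable.of_nonneg_of_le (fun j => mul_nonneg (by positivity) (h0 j)) (fun j => ?_)
    ((summable_geometric_of_lt_one hρ.le hρ1).mul_right (seriesValue b ρ))
  refine le_trans ?_ (seriesValue_pow_le hb0 hb hρ hρ1 hsum j)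
  refine mul_le_of_le_one_left (h0 j) ?_
  rw [div_le_one (by positivity)]
  exact_mod_cast (by omega : 1 ≤ j + 1)

theorem hasSum_logCoeff_one {b : ℕ → ℝ} (hb0 : b 0 = 0) (hb : ∀ k, 0 ≤ b k) {ρ : ℝ}
    (hρ : 0 < ρ) (hρ1 : ρ < 1) (hsum : Summable fun k => b k * ρ ^ k) :
    HasSum (fun k => logCoeff b 1 k * ρ ^ k)
      (∑' j : ℕ, 1 / ((j + 1 : ℕ) : ℝ) * seriesValue b (ρ ^ (j + 1))) := by
  let V : ℕ × ℕ → ℝ := fun p => coeff p.2 (coeff (p.1 + 1) (multisetExponent b)) * ρ ^ p.2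
  have hV0 : ∀ p, 0 ≤ V p := fun p =>
    mul_nonneg (coeff_coeff_multisetExponent_nonneg hb _ _) (by positivity)
  have hrow : ∀ j, HasSum (fun k => V (j, k))
      (1 / ((j + 1 : ℕ) : ℝ) * seriesValue b (ρ ^ (j + 1))) := by
    intro j
    have hinj : Function.Injective fun i : ℕ => (j + 1) * i := fun a b h =>
      Nat.eq_of_mul_eq_mul_left (by omega) h
    refine (hinj.hasSum_iff ?_).1 ?_
    · intro k hk
      simp only [V]
      rw [coeff_coeff_succ_multisetExponent, if_neg, mul_zero, zero_mul]
      rintro ⟨i, rfl⟩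
      exact hk ⟨i, rfl⟩
    · have h := (summable_mul_pow_pow hb hρ hρ1 hsum (j := j + 1) (by omega)).hasSum.mul_left
        (1 / ((j + 1 : ℕ) : ℝ))
      convert! h using 1
      ext i
      simp only [V, Function.comp_apply]
      rw [coeff_coeff_succ_multisetExponent, if_pos (dvd_mul_right _ _),
        Nat.mul_div_cancel_left _ (by omega), pow_mul]
      ring
  have hsumV : Summable V := by
    rw [summable_prod_of_nonneg hV0]
    exact ⟨fun j => (hrow j).summable, (summable_seriesValue_pow hb0 hb hρ hρ1 hsum).congr
      fun j => (hrow j).tsum_eq.symm⟩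
  have hV : HasSum V (∑' j : ℕ, 1 / ((j + 1 : ℕ) : ℝ) * seriesValue b (ρ ^ (j + 1))) := by
    rw [← (hsumV.hasSum.prod_fiberwise hrow).tsum_eq.symm]
    exact hsumV.hasSum
  have hswap := (Equiv.prodComm ℕ ℕ).hasSum_iff.2 hV
  refine hswap.prod_fiberwise fun k => ?_
  have hfin : HasSum (fun j => V (j, k)) (∑ j ∈ Finset.range k, V (j, k)) := by
    refine hasSum_sum_of_ne_finset_zero fun j hj => ?_
    rw [Finset.mem_range, not_lt] at hj
    simp only [V]
    rw [coeff_multisetExponent_eq_zero hb0 (by omega), zero_mul]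
  convert! hfin using 1
  rw [logCoeff, Finset.sum_range_succ', coeff_zero_multisetExponent]
  simp [V, Finset.sum_mul]

/-! ### Coefficients of `(1 - y)^{-a}` -/

theorem negBinomCoeff_nonneg {a : ℝ} (ha : 0 < a) (N : ℕ) : 0 ≤ negBinomCoeff a N :=
  div_nonneg (Finset.prod_nonneg fun j _ => by positivity) (by positivity)

/-- Euler's limit formula for the Gamma function. -/
theorem tendsto_negBinomCoeff_div {a : ℝ} (ha : 0 < a) :
    Tendsto (fun N : ℕ => negBinomCoeff a N / (N : ℝ) ^ (a - 1)) atTop (𝓝 (Real.Gamma a)⁻¹) := by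
  have h1 := (Real.GammaSeq_tendsto_Gamma a).inv₀ (Real.Gamma_pos_of_pos ha).ne'
  have h2 := (tendsto_natCast_div_add_atTop (𝕜 := ℝ) a).mul h1
  rw [one_mul] at h2
  refine h2.congr' ?_
  filter_upwards [eventually_ge_atTop 1] with N hN
  have hN0 : (0 : ℝ) < N := by exact_mod_cast hN
  have hP : 0 < ∏ j ∈ Finset.range N, (a + j) := Finset.prod_pos fun j _ => by positivity
  rw [Real.GammaSeq, negBinomCoeff, Finset.prod_range_succ, Real.rpow_sub_one hN0.ne']
  have : 0 < (N : ℝ) ^ a := Real.rpow_pos_of_pos hN0 a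
  have : (0 : ℝ) < N.factorial := by positivity
  field_simp
  ring

theorem tendsto_negBinomCoeff_sub_div {a : ℝ} (ha : 0 < a) (l : ℕ) :
    Tendsto (fun N : ℕ => negBinomCoeff a (N - l) / (N : ℝ) ^ (a - 1)) atTop
      (𝓝 (Real.Gamma a)⁻¹) := by
  rw [← tendsto_add_atTop_iff_nat l]
  have h1 : Tendsto (fun N : ℕ => ((N : ℝ) / (N + l)) ^ (a - 1)) atTop (𝓝 ((1 : ℝ) ^ (a - 1))) :=
    (tendsto_natCast_div_add_atTop (𝕜 := ℝ) (l : ℝ)).rpow_const (Or.inl one_ne_zero)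
  have h2 := (tendsto_negBinomCoeff_div ha).mul h1
  rw [Real.one_rpow, mul_one] at h2
  refine h2.congr' ?_
  filter_upwards [eventually_ge_atTop 1] with N hN
  have hN0 : (0 : ℝ) < N := by exact_mod_cast hN
  have : 0 < (N : ℝ) ^ (a - 1) := Real.rpow_pos_of_pos hN0 _
  rw [Nat.add_sub_cancel, Nat.cast_add, Real.div_rpow hN0.le (by positivity)]
  field_simp

theorem exists_negBinomCoeff_le {a : ℝ} (ha : 0 < a) :
    ∃ K, 0 ≤ K ∧ ∀ N : ℕ, negBinomCoeff a N ≤ K * ((N : ℝ) + 1) ^ (a - 1) := by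
  have h := tendsto_negBinomCoeff_sub_div ha 1
  have h' := (tendsto_add_atTop_iff_nat 1).2 h
  obtain ⟨K, hK⟩ := h'.bddAbove_range
  have hK' : ∀ N : ℕ, negBinomCoeff a N / ((N : ℝ) + 1) ^ (a - 1) ≤ K := fun N => by
    simpa using hK ⟨N, rfl⟩
  refine ⟨K, (div_nonneg (negBinomCoeff_nonneg ha 0) (by positivity)).trans (hK' 0), fun N => ?_⟩
  exact (div_le_iff₀ (by positivity)).1 (hK' N)

/-- The factor `l + 1` is needed for `a < 1` only, where it follows from `N ≤ (N - l + 1) (l + 1)`. -/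
theorem exists_negBinomCoeff_sub_div_le {a : ℝ} (ha : 0 < a) :
    ∃ K, 0 ≤ K ∧ ∀ N l : ℕ, 1 ≤ N → l ≤ N →
      negBinomCoeff a (N - l) / (N : ℝ) ^ (a - 1) ≤ K * ((l : ℝ) + 1) := by
  obtain ⟨K, hK0, hK⟩ := exists_negBinomCoeff_le ha
  refine ⟨K * max 1 (2 ^ (a - 1)), by positivity, fun N l hN hl => ?_⟩
  have hN0 : (0 : ℝ) < N := by exact_mod_cast hN
  have hlN : (l : ℝ) ≤ N := by exact_mod_cast hl
  have hl0 : (0 : ℝ) ≤ l := by positivity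
  have hNp : 0 < (N : ℝ) ^ (a - 1) := Real.rpow_pos_of_pos hN0 _
  have hN1 : (1 : ℝ) ≤ N := by exact_mod_cast hN
  rw [div_le_iff₀ hNp]
  refine (hK _).trans ?_
  rw [Nat.cast_sub hl]
  set x : ℝ := (N : ℝ) - l + 1 with hx
  have hx0 : 0 < x := by linarith
  suffices hmain : x ^ (a - 1) ≤ max 1 (2 ^ (a - 1)) * ((l : ℝ) + 1) * (N : ℝ) ^ (a - 1) by
    calc K * x ^ (a - 1) ≤ K * (max 1 (2 ^ (a - 1)) * ((l : ℝ) + 1) * (N : ℝ) ^ (a - 1)) :=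
          mul_le_mul_of_nonneg_left hmain hK0
      _ = _ := by ring
  rcases le_total 1 a with h1 | h1
  · calc x ^ (a - 1) ≤ (2 * N) ^ (a - 1) :=
          Real.rpow_le_rpow hx0.le (by linarith) (by linarith)
      _ = 2 ^ (a - 1) * 1 * (N : ℝ) ^ (a - 1) := by
          rw [Real.mul_rpow (by norm_num) hN0.le, mul_one]
      _ ≤ _ := by
          gcongr
          · exact le_max_right _ _
          · linarith
  · have hmul : (N : ℝ) ≤ x * ((l : ℝ) + 1) := by
      rw [hx]
      nlinarith
    have h2 : (N : ℝ) ^ (1 - a) ≤ x ^ (1 - a) * ((l : ℝ) + 1) := by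
      calc (N : ℝ) ^ (1 - a) ≤ (x * ((l : ℝ) + 1)) ^ (1 - a) :=
            Real.rpow_le_rpow hN0.le hmul (by linarith)
        _ = x ^ (1 - a) * ((l : ℝ) + 1) ^ (1 - a) := Real.mul_rpow hx0.le (by linarith)
        _ ≤ x ^ (1 - a) * ((l : ℝ) + 1) := by
            gcongr
            calc ((l : ℝ) + 1) ^ (1 - a) ≤ ((l : ℝ) + 1) ^ (1 : ℝ) :=
                  Real.rpow_le_rpow_of_exponent_le (by linarith) (by linarith)
              _ = (l : ℝ) + 1 := Real.rpow_one _
    have ex : x ^ (a - 1) = (x ^ (1 - a))⁻¹ := by rw [← Real.rpow_neg hx0.le]; congr 1; ring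
    have eN : (N : ℝ) ^ (a - 1) = ((N : ℝ) ^ (1 - a))⁻¹ := by
      rw [← Real.rpow_neg hN0.le]; congr 1; ring
    have hxp : 0 < x ^ (1 - a) := Real.rpow_pos_of_pos hx0 _
    have hNp' : 0 < (N : ℝ) ^ (1 - a) := Real.rpow_pos_of_pos hN0 _
    calc x ^ (a - 1) ≤ 1 * ((l : ℝ) + 1) * (N : ℝ) ^ (a - 1) := by
          rw [ex, eN, one_mul, ← div_eq_mul_inv, inv_eq_one_div, div_le_div_iff₀ hxp hNp']
          linarith
      _ ≤ _ := by
          gcongr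
          exact le_max_left _ _

/-! ### The double asymptotics -/

theorem nat_mul_evalCoeff {b : ℕ → ℝ} (hb0 : b 0 = 0) (y : ℝ) (n : ℕ) :
    (n : ℝ) * evalCoeff b y n =
      ∑ k ∈ Finset.range (n + 1), (k : ℝ) * logCoeff b y k * evalCoeff b y (n - k) := by
  cases n with
  | zero => simp
  | succ n =>
    have h := succ_mul_evalCoeff hb0 y n
    rw [Finset.Nat.sum_antidiagonal_eq_sum_range_succ_mk] at h
    rw [Finset.sum_range_succ', Nat.cast_zero, zero_mul, zero_mul, add_zero, Nat.cast_succ,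
      mul_comm, h]
    refine Finset.sum_congr rfl fun k _ => ?_
    rw [Nat.add_sub_add_right, Nat.cast_succ]
    ring

section shift
variable {c : ℕ → ℝ} {ρ : ℝ} {m : ℕ}

theorem shiftCoeff_nonneg (hc : ∀ k, 0 ≤ c k) (m k : ℕ) : 0 ≤ shiftCoeff c m k := by
  rw [shiftCoeff]
  split_ifs
  · rfl
  · exact hc _

theorem shiftCoeff_zero (c : ℕ → ℝ) (m : ℕ) : shiftCoeff c m 0 = 0 := if_pos rfl

theorem tendsto_shiftCoeff_ratio (h : Tendsto (fun n : ℕ => c n / c (n + 1)) atTop (𝓝 ρ))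
    (m : ℕ) : Tendsto (fun n => shiftCoeff c m n / shiftCoeff c m (n + 1)) atTop (𝓝 ρ) := by
  refine (h.comp (tendsto_add_atTop_nat m)).congr' ?_
  filter_upwards [eventually_ge_atTop 1] with n hn
  rw [shiftCoeff, shiftCoeff, if_neg (by omega), if_neg (by omega), Function.comp_apply,
    add_right_comm]

theorem summable_shiftCoeff (hc : ∀ k, 0 ≤ c k) {z : ℝ} (hz : 0 < z)
    (hs : Summable fun k => c k * z ^ k) (m : ℕ) :
    Summable fun k => shiftCoeff c m k * z ^ k := by
  have h := ((summable_nat_add_iff m).2 hs).mul_right (z ^ m)⁻¹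
  refine Summable.of_nonneg_of_le (fun k => mul_nonneg (shiftCoeff_nonneg hc m k) (by positivity))
    (fun k => ?_) h
  have e : c (k + m) * z ^ (k + m) * (z ^ m)⁻¹ = c (k + m) * z ^ k := by
    rw [pow_add]; field_simp
  rw [e, shiftCoeff]
  split_ifs
  · rw [zero_mul]
    exact mul_nonneg (hc _) (by positivity)
  · rfl

theorem seriesValue_eq_add_shift (hc : ∀ k, 0 ≤ c k) (hm : ∀ k < m, c k = 0) {z : ℝ} (hz : 0 < z)
    (hs : Summable fun k => c k * z ^ k) :
    seriesValue c z = c m * z ^ m + z ^ m * seriesValue (shiftCoeff c m) z := by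
  rw [seriesValue, seriesValue, ← hs.sum_add_tsum_nat_add (m + 1), Finset.sum_range_succ,
    Finset.sum_eq_zero fun k hk => by rw [hm k (Finset.mem_range.1 hk), zero_mul], zero_add,
    (summable_shiftCoeff hc hz hs m).tsum_eq_zero_add, shiftCoeff_zero, zero_mul, zero_add,
    ← tsum_mul_left]
  congr 1
  refine tsum_congr fun k => ?_
  rw [shiftCoeff, if_neg k.succ_ne_zero, show k + (m + 1) = k + 1 + m by ring, pow_add]
  ring

theorem constantTerm_eq (hc : ∀ k, 0 ≤ c k) (hm : ∀ k < m, c k = 0) (hρ : 0 < ρ) (hρ1 : ρ < 1)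
    (hs : Summable fun k => c k * ρ ^ k) (j : ℕ) :
    constantTerm c ρ m (j + 1) =
      1 / ((j + 1 : ℕ) : ℝ) * seriesValue (shiftCoeff c m) (ρ ^ (j + 1)) := by
  rw [constantTerm, seriesValue_eq_add_shift hc hm (by positivity)
    (summable_mul_pow_pow hc hρ hρ1 hs (j := j + 1) (by omega)), ← pow_mul, add_sub_cancel_left]
  field_simp

end shift

section weights
variable {a : ℝ}

/-- The coefficient of `y^{N-l}` in `(1 - y)^{-a}`, divided by `N^{a-1}`; it is `0` for `l > N`. -/
noncomputable def weight (a : ℝ) (N l : ℕ) : ℝ :=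
  if l ≤ N then negBinomCoeff a (N - l) / (N : ℝ) ^ (a - 1) else 0

theorem tendsto_weighted_error (ha : 0 < a) {σ : ℝ} (hσ : 0 < σ) (hσ1 : σ < 1) (K : ℝ)
    (hK : 0 ≤ K) :
    Tendsto (fun N => ∑' l, |weight a N l - (Real.Gamma a)⁻¹| * (K * σ ^ l)) atTop (𝓝 0) ∧
      ∀ N, 1 ≤ N → Summable fun l => |weight a N l - (Real.Gamma a)⁻¹| * (K * σ ^ l) := by
  have hΓ := Real.Gamma_pos_of_pos ha
  obtain ⟨B, hB0, hB⟩ := exists_negBinomCoeff_sub_div_le ha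
  have hgeo : Summable fun l : ℕ => (B * ((l : ℝ) + 1) + (Real.Gamma a)⁻¹) * (K * σ ^ l) := by
    have h1 : Summable fun l : ℕ => (l : ℝ) * σ ^ l := by
      simpa using summable_pow_mul_geometric_of_norm_lt_one 1
        (show ‖σ‖ < 1 by rwa [Real.norm_of_nonneg hσ.le])
    have h2 := summable_geometric_of_lt_one hσ.le hσ1
    refine ((h1.mul_left (B * K)).add (h2.mul_left ((B + (Real.Gamma a)⁻¹) * K))).congr fun l => ?_
    ring
  have hbound : ∀ N, 1 ≤ N → ∀ l, ‖|weight a N l - (Real.Gamma a)⁻¹| * (K * σ ^ l)‖ ≤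
      (B * ((l : ℝ) + 1) + (Real.Gamma a)⁻¹) * (K * σ ^ l) := by
    intro N hN l
    rw [Real.norm_of_nonneg (by positivity)]
    refine mul_le_mul_of_nonneg_right ((abs_sub _ _).trans (add_le_add ?_ ?_)) (by positivity)
    · rw [weight]
      split_ifs with hl
      · rw [abs_of_nonneg (div_nonneg (negBinomCoeff_nonneg ha _) (by positivity))]
        exact hB N l hN hl
      · rw [abs_zero]; positivity
    · rw [abs_of_pos (by positivity)]
  refine ⟨?_, fun N hN => Summable.of_norm_bounded hgeo (hbound N hN)⟩
  have h := tendsto_tsum_of_dominated_convergence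
    (f := fun N l => |weight a N l - (Real.Gamma a)⁻¹| * (K * σ ^ l)) (g := fun _ => 0)
    (𝓕 := atTop) hgeo ?_ ?_
  · simpa using h
  · intro l
    have hw : Tendsto (fun N => weight a N l) atTop (𝓝 (Real.Gamma a)⁻¹) := by
      refine (tendsto_negBinomCoeff_sub_div ha l).congr' ?_
      filter_upwards [eventually_ge_atTop l] with N hN
      rw [weight, if_pos hN]
    have := ((hw.sub_const (Real.Gamma a)⁻¹).abs).mul_const (K * σ ^ l)
    simpa using this
  · filter_upwards [eventually_ge_atTop 1] with N hN
    exact hbound N hN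

end weights

section main
variable {c : ℕ → ℝ} {m : ℕ}

/-- Take one term of `[x^M] G(x, y)` at `y = σ⁻¹ > 1`. -/
theorem exists_multisetCoeff_le {b : ℕ → ℝ} {σ : ℝ} (hb0 : b 0 = 0) (hb : ∀ k, 0 ≤ b k)
    (hσ : 0 < σ) (hσ1 : σ < 1)
    (hratio : Tendsto (fun n : ℕ => b n / b (n + 1)) atTop (𝓝 (σ ^ 2)))
    (hmid : MiddleNegligible b) (hsum : Summable fun k => b k * (σ ^ 2) ^ k) :
    ∃ K, 0 ≤ K ∧ ∀ᶠ M in atTop, ∀ l, multisetCoeff b M l ≤ K * σ ^ l * b M := by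
  have hy : 0 ≤ σ⁻¹ := by positivity
  obtain ⟨K, hK0, hK⟩ := exists_le_mul_of_recurrence hb (by positivity) hratio hmid
    (logCoeff_nonneg hb hy) (tendsto_logCoeff_div hb0 hb hσ hσ1 hy le_rfl hratio hsum)
    (evalCoeff_nonneg hb hy) (nat_mul_evalCoeff hb0 σ⁻¹)
  refine ⟨K, hK0, ?_⟩
  filter_upwards [hK] with M hM l
  by_cases hl : M < l
  · rw [multisetCoeff_eq_zero hb0 hl]
    exact mul_nonneg (by positivity) (hb M)
  · have h1 : multisetCoeff b M l * σ⁻¹ ^ l ≤ evalCoeff b σ⁻¹ M :=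
      Finset.single_le_sum (f := fun l => multisetCoeff b M l * σ⁻¹ ^ l)
        (fun l _ => mul_nonneg (multisetCoeff_nonneg hb M l) (by positivity))
        (Finset.mem_range.2 (by omega))
    have h2 := h1.trans hM
    rw [inv_pow, ← div_eq_mul_inv, div_le_iff₀ (by positivity)] at h2
    linarith

theorem tendsto_evalCoeff_one_div {b : ℕ → ℝ} {σ : ℝ} (hb0 : b 0 = 0) (hb : ∀ k, 0 ≤ b k)
    (hσ : 0 < σ) (hσ1 : σ < 1)
    (hratio : Tendsto (fun n : ℕ => b n / b (n + 1)) atTop (𝓝 (σ ^ 2)))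
    (hmid : MiddleNegligible b) (hsum : Summable fun k => b k * (σ ^ 2) ^ k) :
    Tendsto (fun M => evalCoeff b 1 M / b M) atTop
      (𝓝 (Real.exp (∑' j : ℕ, 1 / ((j + 1 : ℕ) : ℝ) * seriesValue b ((σ ^ 2) ^ (j + 1))))) := by
  have hρ1 : σ ^ 2 < 1 := by nlinarith
  have h := tendsto_div_of_recurrence hb (by positivity) hratio hmid hsum
    (logCoeff_nonneg hb zero_le_one) (tendsto_logCoeff_div hb0 hb hσ hσ1 zero_le_one
      ((one_le_inv₀ hσ).2 hσ1.le) hratio hsum)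
    (evalCoeff_nonneg hb zero_le_one) (nat_mul_evalCoeff hb0 1)
  have hs := hasSum_coeff_exp_subst (logCoeff_nonneg hb zero_le_one) (logCoeff_zero b 1)
    (by positivity) (hasSum_logCoeff_one hb0 hb (by positivity) hρ1 hsum)
  rw [← mk_evalCoeff_eq_exp hb0 1] at hs
  simp only [coeff_mk] at hs
  rwa [hs.tsum_eq, one_mul] at h

/-- The bound on the right depends on `N` only, not on `M`. -/
theorem abs_multisetCoeff_div_sub_le (ha : 0 < c m) (hm : ∀ k < m, c k = 0)
    (hc : ∀ k, 0 ≤ c k) {σ K : ℝ} (hσ : 0 < σ) (hσ1 : σ < 1) (hK : 0 ≤ K) {M N : ℕ} (hN : 1 ≤ N)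
    (hbM : 0 < shiftCoeff c m M)
    (hle : ∀ l, multisetCoeff (shiftCoeff c m) M l ≤ K * σ ^ l * shiftCoeff c m M) :
    |multisetCoeff c (M + m * N) N / ((N : ℝ) ^ (c m - 1) * shiftCoeff c m M) -
        (Real.Gamma (c m))⁻¹ * (evalCoeff (shiftCoeff c m) 1 M / shiftCoeff c m M)| ≤
      ∑' l, |weight (c m) N l - (Real.Gamma (c m))⁻¹| * (K * σ ^ l) := by
  set b := shiftCoeff c m with hb
  have hb0 : b 0 = 0 := shiftCoeff_zero c m
  have hbn : ∀ k, 0 ≤ b k := shiftCoeff_nonneg hc m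
  have e1 : multisetCoeff c (M + m * N) N / ((N : ℝ) ^ (c m - 1) * b M) =
      ∑ l ∈ Finset.range (N + 1 + M), weight (c m) N l * (multisetCoeff b M l / b M) := by
    rw [multisetCoeff_eq_sum hm, Finset.sum_div, Finset.sum_range_add _ (N + 1) M, eq_comm, ← hb]
    rw [Finset.sum_eq_zero (s := Finset.range M), add_zero]
    · refine Finset.sum_congr rfl fun l hl => ?_
      rw [weight, if_pos (by have := Finset.mem_range.1 hl; omega), div_mul_div_comm]
    · intro l _
      rw [weight, if_neg (by omega), zero_mul]
  have e2 : evalCoeff b 1 M / b M =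
      ∑ l ∈ Finset.range (N + 1 + M), multisetCoeff b M l / b M := by
    rw [evalCoeff, show N + 1 + M = M + 1 + N by ring, Finset.sum_range_add _ (M + 1) N,
      Finset.sum_div, eq_comm, Finset.sum_eq_zero (s := Finset.range N), add_zero]
    · simp
    · intro l _
      rw [multisetCoeff_eq_zero hb0 (by omega), zero_div]
  rw [e1, e2, Finset.mul_sum, ← Finset.sum_sub_distrib]
  refine (Finset.abs_sum_le_sum_abs _ _).trans ?_
  refine le_trans (Finset.sum_le_sum fun l _ => ?_)
    (((tendsto_weighted_error ha hσ hσ1 K hK).2 N hN).sum_le_tsum _ fun l _ => by positivity)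
  rw [← sub_mul, abs_mul]
  refine mul_le_mul_of_nonneg_left ?_ (abs_nonneg _)
  rw [abs_of_nonneg (div_nonneg (multisetCoeff_nonneg hbn M l) hbM.le), div_le_iff₀ hbM]
  exact hle l

theorem tendsto_snd_jointlyToInfinity (m : ℕ) :
    Tendsto (fun p : ℕ × ℕ => p.2) (jointlyToInfinity m) atTop :=
  tendsto_comap.mono_left (inf_le_left.trans inf_le_right)

theorem tendsto_sub_jointlyToInfinity (m : ℕ) :
    Tendsto (fun p : ℕ × ℕ => (p.1 : ℤ) - (m : ℤ) * (p.2 : ℤ)) (jointlyToInfinity m) atTop :=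
  tendsto_comap.mono_left inf_le_right

end main

end PowerSeriesPart

theorem theorem1 (c : ℕ → ℝ) (ρ : ℝ) (m : ℕ)
    (hc0 : c 0 = 0)
    (hc : IsSubexponential c ρ)
    (hρ : ρ < 1)
    (hm : IsLeast {k : ℕ | 0 < c k} m) :
    (∀ j : ℕ, 1 ≤ j → Summable fun k : ℕ => c k * (ρ ^ j) ^ k) ∧
    (Summable fun j : ℕ => constantTerm c ρ m (j + 1)) ∧
    (fun p : ℕ × ℕ => multisetCoeff c p.1 p.2) ~[jointlyToInfinity m]
      (fun p : ℕ × ℕ =>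
        multisetConstant c ρ m * (p.2 : ℝ) ^ (c m - 1) * c (p.1 - m * (p.2 - 1))) := by
  have ha : 0 < c m := hm.1
  have hlow : ∀ k < m, c k = 0 := fun k hk =>
    le_antisymm (not_lt.1 fun h => absurd (hm.2 h) (by omega)) (hc.nonneg k)
  obtain ⟨σ, hσ, rfl⟩ : ∃ σ, 0 < σ ∧ ρ = σ ^ 2 :=
    ⟨√ρ, Real.sqrt_pos.2 hc.radius_pos, (Real.sq_sqrt hc.radius_pos.le).symm⟩
  have hσ1 : σ < 1 := by nlinarith
  have hρ0 := hc.radius_pos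
  have hb0 := shiftCoeff_zero c m
  have hb := shiftCoeff_nonneg hc.nonneg m
  have hbratio := tendsto_shiftCoeff_ratio hc.tendsto_ratio m
  have hbsum := summable_shiftCoeff hc.nonneg hρ0 hc.summable m
  have hbmid := hc.middleNegligible.shift hc.nonneg hρ0 hc.tendsto_ratio m
  have hterm := constantTerm_eq hc.nonneg hlow hρ0 hρ hc.summable
  refine ⟨fun j hj => summable_mul_pow_pow hc.nonneg hρ0 hρ hc.summable hj, ?_, ?_⟩
  · simp only [hterm]
    exact summable_seriesValue_pow hb0 hb hρ0 hρ hbsum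
  obtain ⟨K, hK0, hK⟩ := exists_multisetCoeff_le hb0 hb hσ hσ1 hbratio hbmid hbsum
  have hone := tendsto_evalCoeff_one_div hb0 hb hσ hσ1 hbratio hbmid hbsum
  have hpos := eventually_pos_of_tendsto_ratio hb hρ0 hbratio
  set A := multisetConstant c (σ ^ 2) m with hA
  have hApos : 0 < A :=
    mul_pos (inv_pos.2 (Real.Gamma_pos_of_pos ha)) (Real.exp_pos _)
  -- the truncated subtraction agrees with `n - m N` in `ℤ` as soon as the latter is non-negative
  have hN := tendsto_snd_jointlyToInfinity m
  have hM : Tendsto (fun p : ℕ × ℕ => p.1 - m * p.2) (jointlyToInfinity m) atTop := by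
    rw [tendsto_atTop]
    intro K
    filter_upwards [(tendsto_sub_jointlyToInfinity m).eventually_ge_atTop (K : ℤ)] with p hp
    have : ((m * p.2 : ℕ) : ℤ) = (m : ℤ) * p.2 := by push_cast; rfl
    omega
  have hle : ∀ᶠ p in jointlyToInfinity m, m * p.2 ≤ p.1 := by
    filter_upwards [(tendsto_sub_jointlyToInfinity m).eventually_ge_atTop 0] with p hp
    have : ((m * p.2 : ℕ) : ℤ) = (m : ℤ) * p.2 := by push_cast; rfl
    omega
  have hlim : Tendsto (fun p : ℕ × ℕ => multisetCoeff c p.1 p.2 /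
      ((p.2 : ℝ) ^ (c m - 1) * shiftCoeff c m (p.1 - m * p.2))) (jointlyToInfinity m) (𝓝 A) := by
    have h1 : Tendsto (fun p : ℕ × ℕ => (Real.Gamma (c m))⁻¹ *
        (evalCoeff (shiftCoeff c m) 1 (p.1 - m * p.2) / shiftCoeff c m (p.1 - m * p.2)))
        (jointlyToInfinity m) (𝓝 A) := by
      rw [hA, multisetConstant]
      simp only [hterm]
      exact (hone.comp hM).const_mul _
    have h2 : Tendsto (fun p : ℕ × ℕ => multisetCoeff c p.1 p.2 /
        ((p.2 : ℝ) ^ (c m - 1) * shiftCoeff c m (p.1 - m * p.2)) - (Real.Gamma (c m))⁻¹ *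
        (evalCoeff (shiftCoeff c m) 1 (p.1 - m * p.2) / shiftCoeff c m (p.1 - m * p.2)))
        (jointlyToInfinity m) (𝓝 0) := by
      rw [tendsto_zero_iff_abs_tendsto_zero]
      refine squeeze_zero' (Eventually.of_forall fun _ => abs_nonneg _) ?_
        ((tendsto_weighted_error ha hσ hσ1 K hK0).1.comp hN)
      filter_upwards [hle, hM.eventually hK, hM.eventually hpos, hN.eventually_ge_atTop 1]
        with p hp hKp hpp hN1
      have h := abs_multisetCoeff_div_sub_le ha hlow hc.nonneg hσ hσ1 hK0 hN1 hpp hKp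
      rwa [Nat.sub_add_cancel hp] at h
    simpa using h2.add h1
  refine isEquivalent_of_tendsto_one ?_
  have h := hlim.div_const A
  rw [div_self hApos.ne'] at h
  refine h.congr' ?_
  filter_upwards [hle, hN.eventually_ge_atTop 1, hM.eventually_ge_atTop 1] with p hp hN1 hM1
  have e : p.1 - m * (p.2 - 1) = p.1 - m * p.2 + m := by
    rw [Nat.mul_sub, mul_one]
    have := Nat.le_mul_of_pos_right m hN1
    omega
  rw [Pi.div_apply, e, shiftCoeff, if_neg (by omega), div_div]
  congr 1
  ring
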